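/- Let $G$ be a second countable locally compact (Hausdorff) Abelian group with Haar measure $|\cdot|$ and dual group $\widehat G$. A *measure* on $G$ is a complex Radon measure, i.e. a linear functional $\mu$ on $C_c(G)$ such that for every compact $K\subseteq G$ there is $C_K$ with $|\mu(\varphi)|\le C_K\|\varphi\|_\infty$ whenever $\operatorname{supp}\varphi\subseteq K$; $|\mu|$ is its total variation, $\widetilde\varphi(x)=\overline{\varphi(-x)}$, $\widetilde\mu(\varphi)=\overline{\mu(\widetilde\varphi)}$ and $(\varphi*\mu)(t)=\int_G\varphi(t-s)\,d\mu(s)$. The measure $\mu$ is *translation bounded* if $\sup_{t\in G}|\mu|(t+K)<\infty$ for all compact $K\subseteq G$. Let $\mathcal A=(A_n)_n$ be a van Hove sequence in $G$: each $A_n$ is compact with $|A_n|>0$, and $\lim_n|\partial^KA_n|/|A_n|=0$ for each compact $K\subseteq G$, where $\partial^KA=(\overline{A+K}\setminus A)\cup(((G\setminus A)-K)\cap\overline A)$. For translation bounded measures $\mu,\nu$, the *Eberlein convolution* $\mu\circledast_{\mathcal A}\nu$ is the vague limit of $\frac1{|A_n|}\,\mu|_{A_n}*\nu|_{-A_n}$,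 if it exists. The *autocorrelation* $\gamma_\nu$ of $\nu$ along $\mathcal A$ is the vague limit of $\frac1{|A_n|}\,\nu|_{A_n}*\widetilde{\nu|_{A_n}}$, if it exists; its Fourier transform $\widehat{\gamma_\nu}$ is the *diffraction* of $\nu$, that is, the measure on $\widehat G$ such that, for all $\varphi\in C_c(G)$, $|\check\varphi|^2$ is integrable with respect to $|\widehat{\gamma_\nu}|$ and $\gamma_\nu(\varphi*\widetilde\varphi)=\int_{\widehat G}|\check\varphi|^2\,d\widehat{\gamma_\nu}$, where $\check\varphi(\chi)=\int_G\chi(t)\varphi(t)\,dt$. A measure is *continuous* if it has no point masses. If $\nu$ has an autocorrelation along $\mathcal A$, then $\nu$ satisfies the *consistent phase property* along $\mathcal A$ if for every $\chi\in\widehat G$ the Fourier--Bohr coefficient $$a_\chi^{\mathcal A}(\nu)=\lim_n\frac1{|A_n|}\int_{A_n}\overline{\chi(t)}\,d\nu(t)$$ exists and $\widehat{\gamma_\nu}(\{\chi\})=|a_\chi^{\mathcal A}(\nu)|^2$. A translation bounded measure $\mu$ is *Besicovitch almost periodic* along $\mathcal A$ if for all $\varphi\in C_c(G)$ and $\varepsilon>0$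 there is a trigonometric polynomial $P$ (a finite complex linear combination of characters of $G$) with $$\limsup_n\frac1{|A_n|}\int_{A_n}|(\varphi*\mu)(t)-P(t)|\,dt<\varepsilon .$$ **Corollary.** Let $\mu$ be translation bounded and Besicovitch almost periodic along $\mathcal A$. Let $\nu$ be a translation bounded measure whose autocorrelation $\gamma_\nu$ along $\mathcal A$ exists, such that $\widehat{\gamma_\nu}$ is continuous and $\nu$ satisfies the consistent phase property along $\mathcal A$. Then the Eberlein convolutions $\mu\circledast_{\mathcal A}\widetilde\nu$ and $\nu\circledast_{\mathcal A}\widetilde\mu$ exist, and $$\mu\circledast_{\mathcal A}\widetilde\nu=\nu\circledast_{\mathcal A}\widetilde\mu=0 .$$ -/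

import Mathlib

open MeasureTheory Filter Topology
open scoped NNReal ENNReal CompactlySupported Pointwise ComplexConjugate

noncomputable section

/-! ### Radon measures as functionals on the compactly supported continuous functions -/

/-- A (complex) Radon measure on `X`: a linear functional on `C_c(X, ℂ)` which, for every compact
set `K`, is bounded for the supremum norm on the functions supported in `K`. -/
structure RadonMeasure (X : Type*) [TopologicalSpace X] where
  /-- the functional `φ ↦ μ(φ)` -/
  toFun : C_c(X, ℂ) →ₗ[ℂ] ℂ
  /-- `|μ(φ)| ≤ C_K ‖φ‖_∞` whenever `supp φ ⊆ K`; here `M` is any upper bound of `|φ|` -/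
  bound : ∀ K : Set X, IsCompact K → ∃ C : ℝ, ∀ φ : C_c(X, ℂ), tsupport φ ⊆ K →
    ∀ M : ℝ, (∀ x, ‖φ x‖ ≤ M) → ‖toFun φ‖ ≤ C * M

namespace RadonMeasure

section Functional

variable {X : Type*} [TopologicalSpace X]

instance : Zero (RadonMeasure X) :=
  ⟨⟨0, fun _ _ => ⟨0, fun _ _ _ _ => by simp⟩⟩⟩

/-- A nonnegative function in `C_c`, seen as a complex-valued one. -/
def ofNNReal (f : C_c(X, ℝ≥0)) : C_c(X, ℂ) where
  toFun x := ((f x : ℝ) : ℂ)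
  continuous_toFun := by fun_prop
  hasCompactSupport' := f.hasCompactSupport.comp_left (g := fun r : ℝ≥0 => ((r : ℝ) : ℂ)) (by simp)

/-- The values `|μ(ψ)|` for `ψ ∈ C_c` with `|ψ| ≤ f`. -/
def tvValues (μ : RadonMeasure X) (f : C_c(X, ℝ≥0)) : Set ℝ≥0 :=
  {r | ∃ ψ : C_c(X, ℂ), (∀ x, ‖ψ x‖₊ ≤ f x) ∧ r = ‖μ.toFun ψ‖₊}

theorem tvValues_nonempty (μ : RadonMeasure X) (f : C_c(X, ℝ≥0)) : (μ.tvValues f).Nonempty :=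
  ⟨0, 0, by simp, by simp⟩

theorem tvValues_bddAbove (μ : RadonMeasure X) (f : C_c(X, ℝ≥0)) : BddAbove (μ.tvValues f) := by
  obtain ⟨C, hC⟩ := μ.bound (tsupport f) f.hasCompactSupport
  obtain ⟨M, hM⟩ := f.continuous.bddAbove_range_of_hasCompactSupport f.hasCompactSupport
  refine ⟨(C * M).toNNReal, ?_⟩
  rintro r ⟨ψ, hψ, rfl⟩
  refine NNReal.le_toNNReal_of_coe_le ?_
  refine hC ψ (closure_mono fun x hx => ?_) M fun x => ?_
  · intro h
    have h' := hψ x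
    rw [h] at h'
    exact hx (by simpa using h')
  · exact_mod_cast (hψ x).trans (hM ⟨x, rfl⟩)

/-- The total variation of `μ` on a nonnegative function `f ∈ C_c`:
`|μ|(f) = sup {|μ(ψ)| : ψ ∈ C_c, |ψ| ≤ f}`. -/
def tvFun (μ : RadonMeasure X) (f : C_c(X, ℝ≥0)) : ℝ≥0 := sSup (μ.tvValues f)

theorem le_tvFun (μ : RadonMeasure X) {f : C_c(X, ℝ≥0)} {ψ : C_c(X, ℂ)}
    (h : ∀ x, ‖ψ x‖₊ ≤ f x) : ‖μ.toFun ψ‖₊ ≤ μ.tvFun f :=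
  le_csSup (μ.tvValues_bddAbove f) ⟨ψ, h, rfl⟩

theorem tvFun_le (μ : RadonMeasure X) {f : C_c(X, ℝ≥0)} {b : ℝ≥0}
    (h : ∀ ψ : C_c(X, ℂ), (∀ x, ‖ψ x‖₊ ≤ f x) → ‖μ.toFun ψ‖₊ ≤ b) : μ.tvFun f ≤ b :=
  csSup_le (μ.tvValues_nonempty f) (by rintro r ⟨ψ, hψ, rfl⟩; exact h ψ hψ)

theorem exists_rotation (z : ℂ) : ∃ c : ℂ, ‖c‖₊ = 1 ∧ c * z = (‖z‖ : ℂ) := by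
  by_cases hz : z = 0
  · exact ⟨1, by simp, by simp [hz]⟩
  · refine ⟨(‖z‖ : ℂ) / z, ?_, by field_simp⟩
    have : ‖z‖₊ ≠ 0 := by simpa using hz
    rw [nnnorm_div, Complex.nnnorm_real, nnnorm_norm, div_self this]

/-- The part `ψ f / (f + g)` of a function `ψ` with `|ψ| ≤ f + g`. -/
theorem exists_part (f g : C_c(X, ℝ≥0)) (ψ : C_c(X, ℂ)) (h : ∀ x, ‖ψ x‖₊ ≤ (f + g) x) :
    ∃ ψ₁ : C_c(X, ℂ), ∀ x, ψ₁ x = ψ x * ((f x / (f x + g x) : ℝ≥0) : ℝ) := by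
  refine ⟨⟨⟨fun x => ψ x * ((f x / (f x + g x) : ℝ≥0) : ℝ), ?_⟩, ?_⟩, fun _ => rfl⟩
  · rw [continuous_iff_continuousAt]
    intro x
    by_cases hx : f x + g x = 0
    · have hψx : ψ x = 0 := by simpa [hx] using h x
      have h0 : Tendsto (fun y => ‖ψ y‖) (𝓝 x) (𝓝 0) := by
        simpa [hψx] using (ψ.continuous.norm.tendsto x)
      rw [ContinuousAt, hψx, zero_mul]
      refine squeeze_zero_norm (fun y => ?_) h0
      rw [norm_mul]
      refine mul_le_of_le_one_right (norm_nonneg _) ?_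
      rw [Complex.norm_real, NNReal.norm_eq]
      exact_mod_cast div_le_one_of_le₀ (by simp) (by simp)
    · have h1 : ContinuousAt (fun y => f y / (f y + g y)) x :=
        f.continuous.continuousAt.div (f.continuous.add g.continuous).continuousAt hx
      have h2 : Continuous (fun r : ℝ≥0 => ((r : ℝ) : ℂ)) := by fun_prop
      exact ψ.continuous.continuousAt.mul (h2.continuousAt.comp h1)
  · exact ψ.hasCompactSupport.mul_right

theorem tvFun_add (μ : RadonMeasure X) (f g : C_c(X, ℝ≥0)) :
    μ.tvFun (f + g) = μ.tvFun f + μ.tvFun g := by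
  apply le_antisymm
  · refine μ.tvFun_le fun ψ hψ => ?_
    obtain ⟨ψ₁, h₁⟩ := exists_part f g ψ hψ
    obtain ⟨ψ₂, h₂⟩ := exists_part g f ψ (by simpa [add_comm] using hψ)
    have hsum : ψ = ψ₁ + ψ₂ := by
      ext x
      rw [CompactlySupportedContinuousMap.add_apply, h₁, h₂, add_comm (g x), ← mul_add]
      by_cases hx : f x + g x = 0
      · have : ψ x = 0 := by simpa [hx] using hψ x
        simp [this]
      · have : f x / (f x + g x) + g x / (f x + g x) = 1 := by
          rw [← add_div, div_self hx]
        rw [← Complex.ofReal_add, ← NNReal.coe_add, this]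
        simp
    have key : ∀ (u v : ℝ≥0) (z : ℂ), ‖z‖₊ ≤ u + v →
        ‖z * ((u / (u + v) : ℝ≥0) : ℝ)‖₊ ≤ u := by
      intro u v z hz
      rw [nnnorm_mul, Complex.nnnorm_real, NNReal.nnnorm_eq]
      by_cases huv : u + v = 0
      · simp [huv]
      · calc ‖z‖₊ * (u / (u + v)) ≤ (u + v) * (u / (u + v)) := by gcongr
          _ = u := mul_div_cancel₀ u huv
    have e₁ : ‖μ.toFun ψ₁‖₊ ≤ μ.tvFun f := μ.le_tvFun fun x => by
      rw [h₁]; exact key _ _ _ (by simpa using hψ x)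
    have e₂ : ‖μ.toFun ψ₂‖₊ ≤ μ.tvFun g := μ.le_tvFun fun x => by
      rw [h₂]; exact key _ _ _ (by simpa [add_comm] using hψ x)
    rw [hsum, map_add]
    exact (nnnorm_add_le _ _).trans (add_le_add e₁ e₂)
  · have step : ∀ ψ₁ ψ₂ : C_c(X, ℂ), (∀ x, ‖ψ₁ x‖₊ ≤ f x) → (∀ x, ‖ψ₂ x‖₊ ≤ g x) →
        ‖μ.toFun ψ₁‖₊ + ‖μ.toFun ψ₂‖₊ ≤ μ.tvFun (f + g) := by
      intro ψ₁ ψ₂ h₁ h₂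
      obtain ⟨c₁, hc₁, e₁⟩ := exists_rotation (μ.toFun ψ₁)
      obtain ⟨c₂, hc₂, e₂⟩ := exists_rotation (μ.toFun ψ₂)
      have h : ∀ x, ‖(c₁ • ψ₁ + c₂ • ψ₂) x‖₊ ≤ (f + g) x := fun x => by
        refine (nnnorm_add_le _ _).trans (add_le_add ?_ ?_)
        · simpa [nnnorm_mul, hc₁] using h₁ x
        · simpa [nnnorm_mul, hc₂] using h₂ x
      refine le_trans (le_of_eq ?_) (μ.le_tvFun h)
      rw [map_add, map_smul, map_smul, smul_eq_mul, smul_eq_mul, e₁, e₂, ← Complex.ofReal_add,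
        Complex.nnnorm_real]
      ext
      simp [abs_of_nonneg (add_nonneg (norm_nonneg (μ.toFun ψ₁)) (norm_nonneg (μ.toFun ψ₂)))]
    have h1 : ∀ ψ₂ : C_c(X, ℂ), (∀ x, ‖ψ₂ x‖₊ ≤ g x) →
        μ.tvFun f + ‖μ.toFun ψ₂‖₊ ≤ μ.tvFun (f + g) := by
      intro ψ₂ h₂
      have hle : ‖μ.toFun ψ₂‖₊ ≤ μ.tvFun (f + g) :=
        (le_add_of_nonneg_left (by simp)).trans (step 0 ψ₂ (by simp) h₂)
      rw [← le_tsub_iff_right hle]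
      exact μ.tvFun_le fun ψ₁ h₁ => (le_tsub_iff_right hle).2 (step ψ₁ ψ₂ h₁ h₂)
    have hle : μ.tvFun f ≤ μ.tvFun (f + g) :=
      (le_add_of_nonneg_right (by simp)).trans (h1 0 (by simp))
    rw [← le_tsub_iff_left hle]
    exact μ.tvFun_le fun ψ₂ h₂ => (le_tsub_iff_left hle).2 (h1 ψ₂ h₂)

theorem tvFun_smul_le (μ : RadonMeasure X) (c : ℝ≥0) (f : C_c(X, ℝ≥0)) :
    c * μ.tvFun f ≤ μ.tvFun (c • f) := by
  by_cases hc : c = 0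
  · simp [hc]
  rw [mul_comm, ← le_div_iff₀ (pos_iff_ne_zero.2 hc)]
  refine μ.tvFun_le fun ψ hψ => ?_
  rw [le_div_iff₀ (pos_iff_ne_zero.2 hc)]
  have h := μ.le_tvFun (f := c • f) (ψ := ((c : ℝ) : ℂ) • ψ) fun x => by
    simpa [nnnorm_mul] using mul_le_mul_right (hψ x) c
  rwa [map_smul, smul_eq_mul, nnnorm_mul, Complex.nnnorm_real, NNReal.nnnorm_eq, mul_comm] at h

theorem tvFun_smul (μ : RadonMeasure X) (c : ℝ≥0) (f : C_c(X, ℝ≥0)) :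
    μ.tvFun (c • f) = c * μ.tvFun f := by
  apply le_antisymm _ (μ.tvFun_smul_le c f)
  by_cases hc : c = 0
  · subst hc
    refine μ.tvFun_le fun ψ hψ => ?_
    have : ψ = 0 := by ext x; simpa using hψ x
    simp [this]
  · have h := μ.tvFun_smul_le c⁻¹ (c • f)
    rw [smul_smul, inv_mul_cancel₀ hc, one_smul] at h
    calc μ.tvFun (c • f) = c * (c⁻¹ * μ.tvFun (c • f)) := by
          rw [← mul_assoc, mul_inv_cancel₀ hc, one_mul]
      _ ≤ c * μ.tvFun f := by gcongr

/-- The total variation as a positive linear functional. -/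
def tvLinear (μ : RadonMeasure X) : C_c(X, ℝ≥0) →ₗ[ℝ≥0] ℝ≥0 where
  toFun := μ.tvFun
  map_add' := μ.tvFun_add
  map_smul' c f := by simpa using μ.tvFun_smul c f

theorem ofNNReal_le_tvFun (μ : RadonMeasure X) (f : C_c(X, ℝ≥0)) :
    ‖μ.toFun (ofNNReal f)‖ ≤ μ.tvFun f := by
  have := μ.le_tvFun (f := f) (ψ := ofNNReal f) fun x => by simp [ofNNReal]
  exact_mod_cast this

theorem ofNNReal_add (f g : C_c(X, ℝ≥0)) : ofNNReal (f + g) = ofNNReal f + ofNNReal g := by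
  ext x; simp [ofNNReal]

theorem ofNNReal_smul (c : ℝ≥0) (f : C_c(X, ℝ≥0)) :
    ofNNReal (c • f) = ((c : ℝ) : ℂ) • ofNNReal f := by
  ext x; simp [ofNNReal]

/-- The positive functional `|μ| - Re μ`. -/
def defectRe (μ : RadonMeasure X) : C_c(X, ℝ≥0) →ₗ[ℝ≥0] ℝ≥0 where
  toFun f := ⟨μ.tvFun f - (μ.toFun (ofNNReal f)).re,
    sub_nonneg.2 ((Complex.re_le_norm _).trans (μ.ofNNReal_le_tvFun f))⟩
  map_add' f g := by
    apply NNReal.eq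
    change (μ.tvFun (f + g) : ℝ) - (μ.toFun (ofNNReal (f + g))).re =
      ((μ.tvFun f : ℝ) - (μ.toFun (ofNNReal f)).re) +
        ((μ.tvFun g : ℝ) - (μ.toFun (ofNNReal g)).re)
    rw [ofNNReal_add, map_add, Complex.add_re, tvFun_add, NNReal.coe_add]
    ring
  map_smul' c f := by
    apply NNReal.eq
    change (μ.tvFun (c • f) : ℝ) - (μ.toFun (ofNNReal (c • f))).re =
      (c : ℝ) * ((μ.tvFun f : ℝ) - (μ.toFun (ofNNReal f)).re)
    rw [ofNNReal_smul, map_smul, tvFun_smul, smul_eq_mul, NNReal.coe_mul, Complex.re_ofReal_mul]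
    ring

/-- The positive functional `|μ| - Im μ`. -/
def defectIm (μ : RadonMeasure X) : C_c(X, ℝ≥0) →ₗ[ℝ≥0] ℝ≥0 where
  toFun f := ⟨μ.tvFun f - (μ.toFun (ofNNReal f)).im,
    sub_nonneg.2 (((le_abs_self _).trans (Complex.abs_im_le_norm _)).trans
      (μ.ofNNReal_le_tvFun f))⟩
  map_add' f g := by
    apply NNReal.eq
    change (μ.tvFun (f + g) : ℝ) - (μ.toFun (ofNNReal (f + g))).im =
      ((μ.tvFun f : ℝ) - (μ.toFun (ofNNReal f)).im) +
        ((μ.tvFun g : ℝ) - (μ.toFun (ofNNReal g)).im)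
    rw [ofNNReal_add, map_add, Complex.add_im, tvFun_add, NNReal.coe_add]
    ring
  map_smul' c f := by
    apply NNReal.eq
    change (μ.tvFun (c • f) : ℝ) - (μ.toFun (ofNNReal (c • f))).im =
      (c : ℝ) * ((μ.tvFun f : ℝ) - (μ.toFun (ofNNReal f)).im)
    rw [ofNNReal_smul, map_smul, tvFun_smul, smul_eq_mul, NNReal.coe_mul, Complex.im_ofReal_mul]
    ring

end Functional

/-! ### The associated Borel measures and integrals -/

section Borel

variable {X : Type*} [TopologicalSpace X] [T2Space X] [LocallyCompactSpace X]
  [MeasurableSpace X] [BorelSpace X]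

/-- The total variation `|μ|` as a positive regular Borel measure. -/
def tv (μ : RadonMeasure X) : Measure X := NNRealRMK.rieszMeasure μ.tvLinear

/-- The positive regular Borel measure `|μ| - Re μ`. -/
def negRe (μ : RadonMeasure X) : Measure X := NNRealRMK.rieszMeasure μ.defectRe

/-- The positive regular Borel measure `|μ| - Im μ`. -/
def negIm (μ : RadonMeasure X) : Measure X := NNRealRMK.rieszMeasure μ.defectIm

/-- `∫_A f dμ`, where `μ = (|μ| - (|μ| - Re μ)) + i (|μ| - (|μ| - Im μ))` is written as a linear
combination of positive regular Borel measures. -/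
def setIntegral (μ : RadonMeasure X) (A : Set X) (f : X → ℂ) : ℂ :=
  ((∫ x in A, f x ∂μ.tv) - ∫ x in A, f x ∂μ.negRe) +
    Complex.I * ((∫ x in A, f x ∂μ.tv) - ∫ x in A, f x ∂μ.negIm)

/-- `∫ f dμ` over the whole space. -/
def integral (μ : RadonMeasure X) (f : X → ℂ) : ℂ := μ.setIntegral Set.univ f

/-- The point mass `μ({x})`. -/
def mass (μ : RadonMeasure X) (x : X) : ℂ := μ.setIntegral {x} fun _ => 1

/-- `μ` is continuous: it has no point masses. -/
def IsContinuousMeasure (μ : RadonMeasure X) : Prop := ∀ x, μ.mass x = 0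

end Borel

end RadonMeasure

/-! ### Radon measures on a locally compact abelian group -/

section Group

variable {G : Type*} [AddCommGroup G] [TopologicalSpace G] [IsTopologicalAddGroup G]

/-- `φ̃(x) = conj (φ(-x))`. -/
def tildeFun (φ : C_c(G, ℂ)) : C_c(G, ℂ) where
  toFun x := conj (φ (-x))
  continuous_toFun := by fun_prop
  hasCompactSupport' :=
    (φ.hasCompactSupport.comp_homeomorph (Homeomorph.neg G)).comp_left (g := conj) (map_zero _)

theorem tildeFun_apply (φ : C_c(G, ℂ)) (x : G) : tildeFun φ x = conj (φ (-x)) := rfl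

/-- The function `s ↦ φ(t - s)`. -/
def reflectTranslate (φ : C_c(G, ℂ)) (t : G) : C_c(G, ℂ) where
  toFun s := φ (t - s)
  continuous_toFun := by fun_prop
  hasCompactSupport' := φ.hasCompactSupport.comp_homeomorph (Homeomorph.subLeft t)

/-- `μ̃(φ) = conj (μ(φ̃))`. -/
def RadonMeasure.tilde (μ : RadonMeasure G) : RadonMeasure G where
  toFun :=
    { toFun := fun φ => conj (μ.toFun (tildeFun φ))
      map_add' := fun φ ψ => by
        rw [← map_add, ← map_add]
        congr 2
        ext x; simp [tildeFun_apply]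
      map_smul' := fun c φ => by
        have : tildeFun (c • φ) = conj c • tildeFun φ := by ext x; simp [tildeFun_apply]
        rw [this, map_smul, smul_eq_mul, map_mul, Complex.conj_conj]; rfl }
  bound K hK := by
    obtain ⟨C, hC⟩ := μ.bound (-K) hK.neg
    refine ⟨C, fun φ hφ M hM => ?_⟩
    have : ‖μ.toFun (tildeFun φ)‖ ≤ C * M := by
      refine hC _ ?_ M fun x => ?_
      · refine (closure_minimal (fun x hx => ?_) (isClosed_tsupport φ).neg).trans
          (Set.neg_subset_neg.2 hφ)
        refine subset_tsupport φ fun h => hx ?_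
        rw [tildeFun_apply, h, map_zero]
      · simpa [tildeFun_apply] using hM (-x)
    simpa using this

/-- `(φ * μ)(t) = ∫ φ(t - s) dμ(s)`. -/
def convFun (φ : C_c(G, ℂ)) (μ : RadonMeasure G) (t : G) : ℂ := μ.toFun (reflectTranslate φ t)

/-- The dual group of `G`: the continuous homomorphisms from `G` to the unit circle, with the
compact-open topology. -/
abbrev DualGroup (G : Type*) [AddCommGroup G] [TopologicalSpace G] : Type _ :=
  PontryaginDual (Multiplicative G)

instance : MeasurableSpace (DualGroup G) := borel _

instance : BorelSpace (DualGroup G) := ⟨rfl⟩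

/-- The value `χ(t)` of a character, as a complex number. -/
def charEval (χ : DualGroup G) (t : G) : ℂ := (χ (Multiplicative.ofAdd t) : Circle)

/-- The trigonometric polynomial `∑ c_χ χ`. -/
def trigPoly (c : DualGroup G →₀ ℂ) (t : G) : ℂ := c.sum fun χ a => a * charEval χ t

/-- The `K`-boundary `∂^K A`. -/
def kBoundary (K A : Set G) : Set G := (closure (A + K) \ A) ∪ ((Aᶜ - K) ∩ closure A)

variable [MeasurableSpace G]

/-- `A` is a van Hove sequence with respect to the Haar measure `θ`. -/
structure IsVanHove (θ : Measure G) (A : ℕ → Set G) : Prop where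
  isCompact : ∀ n, IsCompact (A n)
  measure_pos : ∀ n, 0 < θ (A n)
  boundary : ∀ K : Set G, IsCompact K →
    Tendsto (fun n => θ (kBoundary K (A n)) / θ (A n)) atTop (𝓝 0)

/-- The Besicovitch 1-seminorm `limsup_n |A_n|⁻¹ ∫_{A_n} |f|`. -/
def besicovitchSeminorm (θ : Measure G) (A : ℕ → Set G) (f : G → ℂ) : ℝ≥0∞ :=
  limsup (fun n => (∫⁻ t in A n, ‖f t‖ₑ ∂θ) / θ (A n)) atTop

/-- Besicovitch almost periodicity along `A` of a (bounded uniformly continuous) function. -/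
def IsBesicovitchAPFun (θ : Measure G) (A : ℕ → Set G) (f : G → ℂ) : Prop :=
  ∀ ε : ℝ≥0∞, 0 < ε → ∃ c : DualGroup G →₀ ℂ,
    besicovitchSeminorm θ A (fun t => f t - trigPoly c t) < ε

/-- Besicovitch almost periodicity along `A` of a measure. -/
def IsBesicovitchAP (θ : Measure G) (A : ℕ → Set G) (μ : RadonMeasure G) : Prop :=
  ∀ φ : C_c(G, ℂ), IsBesicovitchAPFun θ A (convFun φ μ)

/-- The inverse Fourier transform `φ̌(χ) = ∫ χ(t) φ(t) dt`. -/
def inverseFourier (θ : Measure G) (φ : C_c(G, ℂ)) (χ : DualGroup G) : ℂ :=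
  ∫ t, charEval χ t * φ t ∂θ

variable [BorelSpace G] [T2Space G] [LocallyCompactSpace G]

/-- The convolution `φ * φ̃`. -/
def autoConv (θ : Measure G) [θ.IsAddHaarMeasure] (φ : C_c(G, ℂ)) : C_c(G, ℂ) where
  toFun t := ∫ s, φ s * tildeFun φ (t - s) ∂θ
  continuous_toFun := by
    have h : LocallyIntegrable φ θ := φ.continuous.locallyIntegrable
    exact (tildeFun φ).hasCompactSupport.continuous_convolution_right
      (ContinuousLinearMap.mul ℝ ℂ) h (tildeFun φ).continuous
  hasCompactSupport' := by
    exact HasCompactSupport.convolution (μ := θ) (ContinuousLinearMap.mul ℝ ℂ)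
      φ.hasCompactSupport (tildeFun φ).hasCompactSupport

/-- The measure `σ` on the dual group is the Fourier transform of the measure `γ` on `G`. -/
def IsFourierTransform (θ : Measure G) [θ.IsAddHaarMeasure] (γ : RadonMeasure G)
    (σ : RadonMeasure (DualGroup G)) : Prop :=
  ∀ φ : C_c(G, ℂ),
    Integrable (fun χ => ‖inverseFourier θ φ χ‖ ^ 2) σ.tv ∧
      γ.toFun (autoConv θ φ) = σ.integral fun χ => ((‖inverseFourier θ φ χ‖ ^ 2 : ℝ) : ℂ)

/-- `μ` is translation bounded: `sup_t |μ|(t + K) < ∞` for all compact `K`. -/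
def IsTranslationBounded (μ : RadonMeasure G) : Prop :=
  ∀ K : Set G, IsCompact K → ⨆ t : G, μ.tv (t +ᵥ K) < ∞

/-- `(μ|_A * ν|_B)(φ) = ∫_B ∫_A φ(s + t) dμ(s) dν(t)` for compact sets `A` and `B`. -/
def restrictConv (μ : RadonMeasure G) (A : Set G) (ν : RadonMeasure G) (B : Set G)
    (φ : C_c(G, ℂ)) : ℂ :=
  ν.setIntegral B fun t => μ.setIntegral A fun s => φ (s + t)

/-- The Eberlein convolution `μ ⊛_A ν` exists and equals `η`: the measures
`|A_n|⁻¹ μ|_{A_n} * ν|_{-A_n}` converge vaguely to `η`. -/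
def IsEberleinConv (θ : Measure G) (A : ℕ → Set G) (μ ν η : RadonMeasure G) : Prop :=
  ∀ φ : C_c(G, ℂ),
    Tendsto (fun n => ((θ.real (A n) : ℂ))⁻¹ * restrictConv μ (A n) ν (-A n) φ) atTop
      (𝓝 (η.toFun φ))

/-- `γ` is the autocorrelation of `μ` along `A`: the vague limit of
`|A_n|⁻¹ μ|_{A_n} * (μ|_{A_n})~`, where `(μ|_{A_n})~` is the restriction of `μ̃` to `-A_n`. -/
def IsAutocorrelation (θ : Measure G) (A : ℕ → Set G) (μ γ : RadonMeasure G) : Prop :=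
  ∀ φ : C_c(G, ℂ),
    Tendsto (fun n => ((θ.real (A n) : ℂ))⁻¹ * restrictConv μ (A n) μ.tilde (-A n) φ) atTop
      (𝓝 (γ.toFun φ))

/-- The Fourier--Bohr coefficient of `μ` at `χ` along `A` exists and equals `c`. -/
def IsFourierBohrCoeff (θ : Measure G) (A : ℕ → Set G) (μ : RadonMeasure G) (χ : DualGroup G)
    (c : ℂ) : Prop :=
  Tendsto (fun n => ((θ.real (A n) : ℂ))⁻¹ * μ.setIntegral (A n) fun t => conj (charEval χ t)) atTop
    (𝓝 c)

/-- The consistent phase property of `ν` along `A`, where `σ` is the diffraction of `ν` (the Fourier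
transform of its autocorrelation along `A`): all Fourier--Bohr coefficients `a_χ` of `ν` along `A`
exist, and `σ({χ}) = |a_χ|²` for every character `χ`. -/
def SatisfiesCPP (θ : Measure G) (A : ℕ → Set G) (ν : RadonMeasure G)
    (σ : RadonMeasure (DualGroup G)) : Prop :=
  ∀ χ : DualGroup G, ∃ a : ℂ, IsFourierBohrCoeff θ A ν χ a ∧ σ.mass χ = ((‖a‖ ^ 2 : ℝ) : ℂ)

end Group

end

/-! The hypotheses on `ν` enter through one consequence: `|a_χ|² = σ({χ}) = 0`, so every
Fourier–Bohr coefficient of `ν` vanishes (`SatisfiesCPP.isFourierBohrCoeff_zero`) and `ν` is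
orthogonal in the mean to all trigonometric polynomials. It remains to pass from these to `μ`.

Tested against `φ`, the approximant of `μ ⊛ ν̃` is the conjugate of `|A_n|⁻¹ ∫_{A_n} conj (φ' *
μ|_{A_n}) dν`, where `φ'(x) = φ(-x)` (`restrictConv_tilde`). Replacing `μ|_{A_n}` by `μ` changes the
integrand only near the boundary of `A_n`, and the van Hove condition with translation boundedness
makes that set negligible for `|ν|` (`tv_inter_sub_le`). So the claim is that the bounded, uniformly
continuous, Besicovitch almost periodic function `f = φ' * μ` is orthogonal to `ν` in the mean
(`IsBesicovitchAPFun.enorm_setIntegral_conj_le`).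

The difficulty is that `f` is close to a trigonometric polynomial `P` only in Haar mean, which says
nothing about `|ν|` when `ν` is singular. Smoothing by an approximate identity `ψ` overcomes this,
through `f = (f - ψ * f) + ψ * (f - P) + ψ * P`. The first term is uniformly small by uniform
continuity. The second has `|ν|`-mean controlled by the Haar mean of `f - P`, by Fubini and
translation boundedness (`exists_lintegral_smoothing_le`). The third is again a trigonometric
polynomial, hence orthogonal to `ν`.

The second convolution follows from the first: interchanging `μ` and `ν` conjugates the approximants
and replaces `φ` by `φ̃` (`restrictConv_tilde_swap`), and the limit `0` is invariant under this. -/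

noncomputable section

/-! ### Riesz measures of positive functionals -/

namespace NNRealRMK

variable {X : Type*} [TopologicalSpace X] [T2Space X] [LocallyCompactSpace X]
  [MeasurableSpace X] [BorelSpace X]

theorem regular_add [SecondCountableTopology X] (m₁ m₂ : Measure X) [m₁.Regular] [m₂.Regular] :
    (m₁ + m₂).Regular := by
  have : IsFiniteMeasureOnCompacts (m₁ + m₂) := ⟨fun K hK => by
    rw [Measure.add_apply]
    exact ENNReal.add_lt_top.2 ⟨hK.measure_lt_top, hK.measure_lt_top⟩⟩
  infer_instance

/-- Regular measures are determined by their integrals over `C_c`; second countability is what makes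
the sum regular. -/
theorem rieszMeasure_add [SecondCountableTopology X] (Λ₁ Λ₂ : C_c(X, ℝ≥0) →ₗ[ℝ≥0] ℝ≥0) :
    rieszMeasure (Λ₁ + Λ₂) = rieszMeasure Λ₁ + rieszMeasure Λ₂ := by
  have := regular_add (rieszMeasure Λ₁) (rieszMeasure Λ₂)
  apply Measure.ext_of_integral_eq_on_compactlySupported_nnreal
  intro f
  have hf : ∀ Λ : C_c(X, ℝ≥0) →ₗ[ℝ≥0] ℝ≥0,
      Integrable (fun x => (f x : ℝ)) (rieszMeasure Λ) := fun Λ =>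
    Continuous.integrable_of_hasCompactSupport (by fun_prop)
      (HasCompactSupport.comp_left f.hasCompactSupport rfl)
  rw [integral_add_measure (hf _) (hf _)]
  simp

/-- The difference of two positive functionals, one below the other. -/
def functionalSub (Λ₁ Λ₂ : C_c(X, ℝ≥0) →ₗ[ℝ≥0] ℝ≥0) (h : ∀ f, Λ₁ f ≤ Λ₂ f) :
    C_c(X, ℝ≥0) →ₗ[ℝ≥0] ℝ≥0 where
  toFun f := Λ₂ f - Λ₁ f
  map_add' f g := by
    rw [map_add, map_add]
    exact tsub_add_tsub_comm (h f) (h g) |>.symm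
  map_smul' c f := by
    rw [map_smul, map_smul, RingHom.id_apply, smul_eq_mul, smul_eq_mul, smul_eq_mul, mul_tsub]

/-- The difference of the functionals is itself positive and linear, so the larger Riesz measure is
the smaller one plus another Riesz measure. -/
theorem rieszMeasure_mono [SecondCountableTopology X] {Λ₁ Λ₂ : C_c(X, ℝ≥0) →ₗ[ℝ≥0] ℝ≥0}
    (h : ∀ f, Λ₁ f ≤ Λ₂ f) : rieszMeasure Λ₁ ≤ rieszMeasure Λ₂ := by
  have : Λ₂ = Λ₁ + functionalSub Λ₁ Λ₂ h := by
    ext f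
    simp [functionalSub, add_tsub_cancel_of_le (h f)]
  rw [this, rieszMeasure_add]
  exact Measure.le_add_right le_rfl

end NNRealRMK

namespace RadonMeasure

section Borel

variable {X : Type*} [TopologicalSpace X] [T2Space X] [LocallyCompactSpace X]
  [MeasurableSpace X] [BorelSpace X] (μ : RadonMeasure X)

instance : μ.tv.Regular := NNRealRMK.rieszMeasure_regular _
instance : μ.negRe.Regular := NNRealRMK.rieszMeasure_regular _
instance : μ.negIm.Regular := NNRealRMK.rieszMeasure_regular _

/-! ### The functional as an integral -/

/-- The total variation cancels: `|μ| - (|μ| - Re μ) = Re μ`, and likewise for `Im μ`. -/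
theorem integral_ofNNReal (f : C_c(X, ℝ≥0)) : μ.integral (ofNNReal f) = μ.toFun (ofNNReal f) := by
  have key : ∀ Λ : C_c(X, ℝ≥0) →ₗ[ℝ≥0] ℝ≥0,
      ∫ x, ofNNReal f x ∂NNRealRMK.rieszMeasure Λ = ((Λ f : ℝ) : ℂ) := fun Λ => by
    rw [← NNRealRMK.integral_rieszMeasure Λ f, ← integral_complex_ofReal]
    rfl
  simp only [integral, setIntegral, Measure.restrict_univ]
  rw [tv, negRe, negIm, key, key, key]
  have h1 : (μ.tvLinear f : ℝ) = μ.tvFun f := rfl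
  have h2 : (μ.defectRe f : ℝ) = μ.tvFun f - (μ.toFun (ofNNReal f)).re := rfl
  have h3 : (μ.defectIm f : ℝ) = μ.tvFun f - (μ.toFun (ofNNReal f)).im := rfl
  rw [h1, h2, h3]
  apply Complex.ext <;> simp

theorem setIntegral_add {A : Set X} {f g : X → ℂ}
    (hf : ∀ m : Measure X, [m.Regular] → IntegrableOn f A m)
    (hg : ∀ m : Measure X, [m.Regular] → IntegrableOn g A m) :
    μ.setIntegral A (fun x => f x + g x) = μ.setIntegral A f + μ.setIntegral A g := by
  simp only [setIntegral]
  rw [integral_add (hf _) (hg _), integral_add (hf _) (hg _), integral_add (hf _) (hg _)]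
  ring

theorem setIntegral_const_mul (A : Set X) (c : ℂ) (f : X → ℂ) :
    μ.setIntegral A (fun x => c * f x) = c * μ.setIntegral A f := by
  simp only [setIntegral, integral_const_mul]
  ring

omit [T2Space X] [LocallyCompactSpace X] in
theorem integrable_compactlySupported (f : C_c(X, ℂ)) (m : Measure X) [m.Regular] :
    Integrable f m :=
  f.continuous.integrable_of_hasCompactSupport f.hasCompactSupport

theorem integral_add_compactlySupported (f g : C_c(X, ℂ)) :
    μ.integral (f + g) = μ.integral f + μ.integral g :=
  μ.setIntegral_add (fun m _ => (integrable_compactlySupported f m).integrableOn)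
    (fun m _ => (integrable_compactlySupported g m).integrableOn)

/-- The nonnegative part of `Re (c f)`. -/
def rePart (c : ℂ) (f : C_c(X, ℂ)) : C_c(X, ℝ≥0) where
  toFun x := (c * f x).re.toNNReal
  continuous_toFun := by fun_prop
  hasCompactSupport' := f.hasCompactSupport.comp_left (g := fun z => (c * z).re.toNNReal) (by simp)

omit [T2Space X] [LocallyCompactSpace X] [MeasurableSpace X] [BorelSpace X] in
-- The four terms are the positive and negative parts of `Re f` and of `Im f = Re (-i f)`. This
-- carries identities from nonnegative functions to all of `C_c`.
theorem eq_sum_rePart (f : C_c(X, ℂ)) :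
    f = ofNNReal (rePart 1 f) + (-1 : ℂ) • ofNNReal (rePart (-1) f) +
      (Complex.I • ofNNReal (rePart (-Complex.I) f) +
        (-Complex.I) • ofNNReal (rePart Complex.I f)) := by
  ext x
  have h : ∀ r : ℝ, max r 0 - max (-r) 0 = r := fun r => by
    rcases le_total 0 r with hr | hr <;> simp [hr]
  have h1 := h (f x).re
  have h2 := h (f x).im
  apply Complex.ext <;> simp [ofNNReal, rePart, Real.coe_toNNReal'] <;> linarith

theorem integral_eq_toFun (f : C_c(X, ℂ)) : μ.integral f = μ.toFun f := by
  have hs : ∀ (c : ℂ) (g : C_c(X, ℝ≥0)), μ.integral (c • ofNNReal g) = c * μ.toFun (ofNNReal g) :=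
    fun c g => by
      rw [← integral_ofNNReal]
      exact μ.setIntegral_const_mul _ _ _
  have hP : ∀ (c : ℂ) (g : C_c(X, ℝ≥0)),
      μ.integral (c • ofNNReal g : C_c(X, ℂ)) = μ.toFun (c • ofNNReal g) := fun c g => by
    rw [map_smul]
    exact hs c g
  have hadd : ∀ g h : C_c(X, ℂ), μ.integral g = μ.toFun g → μ.integral h = μ.toFun h →
      μ.integral (g + h : C_c(X, ℂ)) = μ.toFun (g + h) := fun g h hg hh => by
    rw [map_add, ← hg, ← hh]
    exact μ.integral_add_compactlySupported g h
  have h1 : ∀ g : C_c(X, ℝ≥0), μ.integral (ofNNReal g) = μ.toFun (ofNNReal g) :=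
    μ.integral_ofNNReal
  rw [eq_sum_rePart f]
  exact hadd _ _ (hadd _ _ (h1 _) (hP _ _)) (hadd _ _ (hP _ _) (hP _ _))

/-! ### Domination by the total variation -/

variable [SecondCountableTopology X]

/-- On nonnegative `f`, `-Re μ(f) ≤ |μ(f)| ≤ |μ|(f)`. -/
theorem negRe_le : μ.negRe ≤ μ.tv + μ.tv := by
  rw [negRe, tv, ← NNRealRMK.rieszMeasure_add]
  refine NNRealRMK.rieszMeasure_mono fun f => ?_
  have h1 := μ.ofNNReal_le_tvFun f
  have h2 := (abs_le.1 (Complex.abs_re_le_norm (μ.toFun (ofNNReal f)))).1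
  have : (μ.tvFun f : ℝ) - (μ.toFun (ofNNReal f)).re ≤ μ.tvFun f + μ.tvFun f := by linarith
  exact_mod_cast this

theorem negIm_le : μ.negIm ≤ μ.tv + μ.tv := by
  rw [negIm, tv, ← NNRealRMK.rieszMeasure_add]
  refine NNRealRMK.rieszMeasure_mono fun f => ?_
  have h1 := μ.ofNNReal_le_tvFun f
  have h2 := (abs_le.1 (Complex.abs_im_le_norm (μ.toFun (ofNNReal f)))).1
  have : (μ.tvFun f : ℝ) - (μ.toFun (ofNNReal f)).im ≤ μ.tvFun f + μ.tvFun f := by linarith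
  exact_mod_cast this

/-- The constant `6 = (1 + 2) + (1 + 2)` counts `|μ|` once and each defect measure as at most
`2|μ|`. It is not sharp, but only some absolute constant matters below. -/
theorem enorm_setIntegral_le (A : Set X) (f : X → ℂ) :
    ‖μ.setIntegral A f‖ₑ ≤ 6 * ∫⁻ x in A, ‖f x‖ₑ ∂μ.tv := by
  have h0 := enorm_integral_le_lintegral_enorm (μ := μ.tv.restrict A) f
  have h1 : ∀ m : Measure X, m ≤ μ.tv + μ.tv →
      ‖∫ x in A, f x ∂m‖ₑ ≤ (∫⁻ x in A, ‖f x‖ₑ ∂μ.tv) + ∫⁻ x in A, ‖f x‖ₑ ∂μ.tv := fun m hm => by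
    refine (enorm_integral_le_lintegral_enorm f).trans ?_
    rw [← lintegral_add_measure, ← Measure.restrict_add]
    exact lintegral_mono' (Measure.restrict_mono le_rfl hm) le_rfl
  have h2 := h1 _ μ.negRe_le
  have h3 := h1 _ μ.negIm_le
  set L := ∫⁻ x in A, ‖f x‖ₑ ∂μ.tv
  calc ‖μ.setIntegral A f‖ₑ ≤ (L + (L + L)) + (L + (L + L)) := by
        refine (enorm_add_le _ _).trans (add_le_add ?_ ?_)
        · exact enorm_sub_le.trans (add_le_add h0 h2)
        · rw [enorm_mul, show ‖Complex.I‖ₑ = 1 by simp [enorm], one_mul]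
          exact enorm_sub_le.trans (add_le_add h0 h3)
    _ = 6 * L := by ring

omit [SecondCountableTopology X] in
theorem setIntegral_congr {A : Set X} (hA : MeasurableSet A) {f g : X → ℂ}
    (h : ∀ x ∈ A, f x = g x) : μ.setIntegral A f = μ.setIntegral A g := by
  simp only [setIntegral]
  rw [setIntegral_congr_fun hA h, setIntegral_congr_fun hA h, setIntegral_congr_fun hA h]

omit [SecondCountableTopology X] in
theorem integral_eq_add_compl {A : Set X} (hA : MeasurableSet A) (f : C_c(X, ℂ)) :
    μ.integral f = μ.setIntegral A f + μ.setIntegral Aᶜ f := by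
  have h : ∀ m : Measure X, [m.Regular] → ∫ x, f x ∂m = (∫ x in A, f x ∂m) + ∫ x in Aᶜ, f x ∂m :=
    fun m _ => (integral_add_compl hA (integrable_compactlySupported f m)).symm
  simp only [integral, setIntegral, Measure.restrict_univ]
  rw [h μ.tv, h μ.negRe, h μ.negIm]
  ring

end Borel

end RadonMeasure

namespace RadonMeasure

/-! ### Reflection and Fubini -/

section Reflection

variable {G : Type*} [AddCommGroup G] [TopologicalSpace G] [IsTopologicalAddGroup G]

/-- The reflection `f ↦ f(-·)` on nonnegative compactly supported functions. -/
def reflect : C_c(G, ℝ≥0) →ₗ[ℝ≥0] C_c(G, ℝ≥0) where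
  toFun f :=
    { toFun := fun x => f (-x)
      continuous_toFun := by fun_prop
      hasCompactSupport' := f.hasCompactSupport.comp_homeomorph (Homeomorph.neg G) }
  map_add' _ _ := rfl
  map_smul' _ _ := rfl

theorem reflect_apply (f : C_c(G, ℝ≥0)) (x : G) : reflect f x = f (-x) := rfl

theorem tilde_apply (μ : RadonMeasure G) (φ : C_c(G, ℂ)) :
    μ.tilde.toFun φ = conj (μ.toFun (tildeFun φ)) := rfl

theorem tildeFun_tildeFun (φ : C_c(G, ℂ)) : tildeFun (tildeFun φ) = φ := by
  ext x
  simp [tildeFun_apply]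

theorem tildeFun_ofNNReal (f : C_c(G, ℝ≥0)) : tildeFun (ofNNReal f) = ofNNReal (reflect f) := by
  ext x
  exact Complex.conj_ofReal _

/-- The involution `ψ ↦ ψ̃` matches the functions dominated by `f` with those dominated by its
reflection, and preserves `|μ(ψ)|`. -/
theorem tvFun_tilde (μ : RadonMeasure G) (f : C_c(G, ℝ≥0)) :
    μ.tilde.tvFun f = μ.tvFun (reflect f) := by
  apply le_antisymm
  · refine tvFun_le _ fun ψ hψ => ?_
    have := μ.le_tvFun (f := reflect f) (ψ := tildeFun ψ) fun x => by
      simpa [tildeFun_apply, reflect_apply] using hψ (-x)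
    simpa [tilde_apply] using this
  · refine tvFun_le _ fun ψ hψ => ?_
    have := μ.tilde.le_tvFun (f := f) (ψ := tildeFun ψ) fun x => by
      simpa [tildeFun_apply, reflect_apply] using hψ (-x)
    simpa [tilde_apply, tildeFun_tildeFun] using this

variable [T2Space G] [LocallyCompactSpace G] [MeasurableSpace G] [BorelSpace G]

theorem rieszMeasure_comp_reflect (Λ : C_c(G, ℝ≥0) →ₗ[ℝ≥0] ℝ≥0) :
    NNRealRMK.rieszMeasure (Λ ∘ₗ reflect) =
      (NNRealRMK.rieszMeasure Λ).map (MeasurableEquiv.neg G) := by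
  have : ((NNRealRMK.rieszMeasure Λ).map (MeasurableEquiv.neg G)).Regular :=
    Measure.Regular.map (Homeomorph.neg G)
  apply Measure.ext_of_integral_eq_on_compactlySupported_nnreal
  intro f
  rw [integral_map_equiv, NNRealRMK.integral_rieszMeasure]
  exact (NNRealRMK.integral_rieszMeasure Λ (reflect f)).symm

theorem tv_tilde (μ : RadonMeasure G) : μ.tilde.tv = μ.tv.map (MeasurableEquiv.neg G) := by
  rw [tv, tv, ← rieszMeasure_comp_reflect]
  congr 1
  ext f
  exact congrArg NNReal.toReal (μ.tvFun_tilde f)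

theorem negRe_tilde (μ : RadonMeasure G) :
    μ.tilde.negRe = μ.negRe.map (MeasurableEquiv.neg G) := by
  rw [negRe, negRe, ← rieszMeasure_comp_reflect]
  congr 1
  ext f
  change (μ.tilde.tvFun f : ℝ) - (μ.tilde.toFun (ofNNReal f)).re =
    μ.tvFun (reflect f) - (μ.toFun (ofNNReal (reflect f))).re
  rw [tvFun_tilde, tilde_apply, tildeFun_ofNNReal, Complex.conj_re]

variable [SecondCountableTopology G]

/-- Conjugation flips the sign of `Im μ`, so `|μ̃| - Im μ̃` is the reflection of `|μ| + Im μ`. The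
additive form avoids subtracting measures. -/
theorem negIm_tilde (μ : RadonMeasure G) :
    μ.tilde.negIm + μ.negIm.map (MeasurableEquiv.neg G) =
      μ.tv.map (MeasurableEquiv.neg G) + μ.tv.map (MeasurableEquiv.neg G) := by
  rw [negIm, negIm, tv, ← rieszMeasure_comp_reflect, ← rieszMeasure_comp_reflect,
    ← NNRealRMK.rieszMeasure_add, ← NNRealRMK.rieszMeasure_add]
  congr 1
  ext f
  change ((μ.tilde.tvFun f : ℝ) - (μ.tilde.toFun (ofNNReal f)).im) +
    (μ.tvFun (reflect f) - (μ.toFun (ofNNReal (reflect f))).im) =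
    μ.tvFun (reflect f) + μ.tvFun (reflect f)
  rw [tvFun_tilde, tilde_apply, tildeFun_ofNNReal, Complex.conj_im]
  ring

theorem setIntegral_tilde (μ : RadonMeasure G) {A : Set G} (hA : IsCompact A) {f : G → ℂ}
    (hf : Continuous f) :
    μ.tilde.setIntegral (-A) f = conj (μ.setIntegral A fun t => conj (f (-t))) := by
  have hm : ∀ m : Measure G, ∫ x in -A, f x ∂m.map (MeasurableEquiv.neg G) =
      ∫ x in A, f (-x) ∂m := fun m => by
    rw [setIntegral_map_equiv]
    simp
  have hi : ∀ m : Measure G, [m.Regular] → IntegrableOn f (-A) m := fun m _ =>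
    hf.continuousOn.integrableOn_compact hA.neg
  have hr : (μ.negIm.map (MeasurableEquiv.neg G)).Regular :=
    Measure.Regular.map (Homeomorph.neg G)
  have hr' : (μ.tv.map (MeasurableEquiv.neg G)).Regular :=
    Measure.Regular.map (Homeomorph.neg G)
  have him : (∫ x in -A, f x ∂μ.tilde.negIm) + ∫ x in A, f (-x) ∂μ.negIm =
      (∫ x in A, f (-x) ∂μ.tv) + ∫ x in A, f (-x) ∂μ.tv := by
    rw [← hm μ.negIm, ← hm μ.tv, ← integral_add_measure (hi _) (hi _), ← Measure.restrict_add,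
      negIm_tilde, Measure.restrict_add, integral_add_measure (hi _) (hi _)]
  simp only [setIntegral, integral_conj, map_add, map_sub, map_mul, Complex.conj_conj,
    Complex.conj_I]
  rw [negRe_tilde, tv_tilde, hm, hm, ← sub_eq_zero]
  -- Only the imaginary defect fails to be a plain reflection; its sign flip is absorbed by `conj i
  -- = -i`.
  linear_combination (-Complex.I) * him

end Reflection

section Fubini

variable {X Y : Type*} [TopologicalSpace X] [T2Space X] [LocallyCompactSpace X]
  [SecondCountableTopology X] [MeasurableSpace X] [BorelSpace X]
  [TopologicalSpace Y] [T2Space Y] [LocallyCompactSpace Y]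
  [SecondCountableTopology Y] [MeasurableSpace Y] [BorelSpace Y]

omit [MeasurableSpace X] [BorelSpace X] [SecondCountableTopology Y] in
theorem continuous_setIntegral (μ : RadonMeasure Y) {B : Set Y} (hB : IsCompact B)
    {F : X → Y → ℂ} (hF : Continuous F.uncurry) :
    Continuous fun x => μ.setIntegral B (F x) := by
  have h : ∀ m : Measure Y, [m.Regular] → Continuous fun x => ∫ y in B, F x y ∂m := fun m _ =>
    continuous_parametric_integral_of_continuous hF hB
  have h1 := h μ.tv
  have h2 := h μ.negRe
  have h3 := h μ.negIm
  exact (h1.sub h2).add (continuous_const.mul (h1.sub h3))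

omit [TopologicalSpace X] [T2Space X] [LocallyCompactSpace X]
  [SecondCountableTopology X] [BorelSpace X] [SecondCountableTopology Y] in
theorem integral_setIntegral {m : Measure X} (ν : RadonMeasure Y) {B : Set Y} {F : X → Y → ℂ}
    (h : ∀ (n : Measure Y) [n.Regular], Integrable (fun x => ∫ y in B, F x y ∂n) m) :
    ∫ x, ν.setIntegral B (fun y => F x y) ∂m =
      ((∫ x, ∫ y in B, F x y ∂ν.tv ∂m) - ∫ x, ∫ y in B, F x y ∂ν.negRe ∂m) +
        Complex.I * ((∫ x, ∫ y in B, F x y ∂ν.tv ∂m) - ∫ x, ∫ y in B, F x y ∂ν.negIm ∂m) := by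
  simp only [setIntegral]
  have h1 := h ν.tv
  have h2 := h ν.negRe
  have h3 := h ν.negIm
  rw [← integral_sub h1 h2, ← integral_sub h1 h3, ← integral_const_mul]
  exact integral_add (h1.sub h2) ((h1.sub h3).const_mul _)

/-- Fubini holds for each pair of positive regular measures making up `μ` and `ν`, a continuous
function being integrable on the compact set `A × B`; the rest is bilinearity. -/
theorem setIntegral_setIntegral_swap (μ : RadonMeasure X) (ν : RadonMeasure Y) {A : Set X}
    {B : Set Y} (hA : IsCompact A) (hB : IsCompact B) {F : X → Y → ℂ}
    (hF : Continuous F.uncurry) :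
    (μ.setIntegral A fun x => ν.setIntegral B fun y => F x y) =
      ν.setIntegral B fun y => μ.setIntegral A fun x => F x y := by
  have hF' : Continuous (fun (y : Y) (x : X) => F x y).uncurry := hF.comp continuous_swap
  have c1 : ∀ (m : Measure X) [m.Regular] (n : Measure Y) [n.Regular],
      Integrable (fun x => ∫ y in B, F x y ∂n) (m.restrict A) := fun m _ n _ =>
    (continuous_parametric_integral_of_continuous hF hB).continuousOn.integrableOn_compact hA
  have c2 : ∀ (m : Measure X) [m.Regular] (n : Measure Y) [n.Regular],
      Integrable (fun y => ∫ x in A, F x y ∂m) (n.restrict B) := fun m _ n _ =>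
    (continuous_parametric_integral_of_continuous hF' hA).continuousOn.integrableOn_compact hB
  have sw : ∀ (m : Measure X) [m.Regular] (n : Measure Y) [n.Regular],
      ∫ x in A, ∫ y in B, F x y ∂n ∂m = ∫ y in B, ∫ x in A, F x y ∂m ∂n := fun m _ n _ => by
    apply integral_integral_swap
    rw [Measure.prod_restrict]
    exact hF.continuousOn.integrableOn_compact (hA.prod hB)
  rw [setIntegral, ν.integral_setIntegral (c1 _), ν.integral_setIntegral (c1 _),
    ν.integral_setIntegral (c1 _), setIntegral, μ.integral_setIntegral (c2 · _),
    μ.integral_setIntegral (c2 · _), μ.integral_setIntegral (c2 · _)]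
  simp only [sw]
  ring

end Fubini

end RadonMeasure

/-! ### Truncated convolutions with a reflected measure -/

section Convolution

variable {G : Type*} [AddCommGroup G] [TopologicalSpace G] [IsTopologicalAddGroup G]
  [T2Space G] [LocallyCompactSpace G] [SecondCountableTopology G]
  [MeasurableSpace G] [BorelSpace G]

/-- Moving the reflection from `ν` to the integrand turns the inner integral into a truncated
convolution of the reflected `φ` with `μ`, evaluated at `t`. -/
theorem restrictConv_tilde (μ ν : RadonMeasure G) {A : Set G} (hA : IsCompact A) (φ : C_c(G, ℂ)) :
    restrictConv μ A ν.tilde (-A) φ =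
      conj (ν.setIntegral A fun t => conj (μ.setIntegral A fun s => φ (s - t))) := by
  have hc : Continuous fun t => μ.setIntegral A fun s => φ (s + t) :=
    μ.continuous_setIntegral hA (F := fun t s => φ (s + t)) (by
      simp only [Function.uncurry_def]; fun_prop)
  rw [restrictConv, RadonMeasure.setIntegral_tilde ν hA hc]
  simp only [sub_eq_add_neg]

theorem restrictConv_tilde_swap (μ ν : RadonMeasure G) {A : Set G} (hA : IsCompact A)
    (φ : C_c(G, ℂ)) :
    restrictConv ν A μ.tilde (-A) φ = conj (restrictConv μ A ν.tilde (-A) (tildeFun φ)) := by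
  have h1 : restrictConv ν A μ.tilde (-A) φ =
      ν.setIntegral A fun s => μ.tilde.setIntegral (-A) fun t => φ (s + t) :=
    RadonMeasure.setIntegral_setIntegral_swap μ.tilde ν hA.neg hA (F := fun t s => φ (s + t)) (by
      simp only [Function.uncurry_def]; fun_prop)
  have h2 : ∀ s, μ.tilde.setIntegral (-A) (fun t => φ (s + t)) =
      conj (μ.setIntegral A fun t => tildeFun φ (t - s)) := fun s => by
    rw [RadonMeasure.setIntegral_tilde μ hA (by fun_prop)]
    simp only [tildeFun_apply, neg_sub]
    simp only [sub_eq_add_neg]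
  rw [restrictConv_tilde μ ν hA, Complex.conj_conj, h1]
  simp only [h2]

end Convolution

/-! ### Van Hove boundaries of sums and differences -/

section Boundary

variable {G : Type*} [AddCommGroup G] [TopologicalSpace G]

theorem IsVanHove.kBoundary_le [MeasurableSpace G] {θ : Measure G} [IsFiniteMeasureOnCompacts θ]
    {A : ℕ → Set G} (hA : IsVanHove θ A) {K : Set G} (hK : IsCompact K) {ε : ℝ≥0∞} (hε : 0 < ε) :
    ∀ᶠ n in atTop, θ (kBoundary K (A n)) ≤ ε * θ (A n) := by
  filter_upwards [ENNReal.tendsto_nhds_zero.1 (hA.boundary K hK) ε hε] with n hn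
  rwa [ENNReal.div_le_iff (hA.measure_pos n).ne' (hA.isCompact n).measure_lt_top.ne] at hn

theorem add_subset_union_kBoundary {A U V : Set G} (hUV : U ⊆ V) :
    A + U ⊆ A ∪ kBoundary V A := by
  intro x hx
  by_cases h : x ∈ A
  · exact Or.inl h
  · exact Or.inr (Or.inl ⟨subset_closure (Set.add_subset_add_left hUV hx), h⟩)

/-- Take `a = b - k` in `A` with `b ∉ A`. If `a + u ∈ A`, then `a + u = b - (k - u)` lies in the
inner `(K - V)`-boundary; otherwise `a + u` lies in the outer `V`-boundary. -/
theorem inter_sub_add_subset_kBoundary {A U V K : Set G} (hUV : U ⊆ V) :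
    A ∩ (Aᶜ - K) + U ⊆ kBoundary ((K - V) ∪ V) A := by
  rintro _ ⟨a, ⟨ha, b, hb, k, hk, rfl⟩, u, hu, rfl⟩
  by_cases h : b - k + u ∈ A
  · refine Or.inr ⟨⟨b, hb, k - u, Or.inl ⟨k, hk, u, hUV hu, rfl⟩, ?_⟩, subset_closure h⟩
    change b - (k - u) = b - k + u
    abel
  · exact Or.inl ⟨subset_closure ⟨b - k, ha, u, Or.inr (hUV hu), rfl⟩, h⟩

end Boundary

/-! ### Comparison of a translation bounded measure with Haar measure -/

namespace IsTranslationBounded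

variable {G : Type*} [AddCommGroup G] [TopologicalSpace G] [IsTopologicalAddGroup G]
  [MeasurableSpace G] [BorelSpace G] [T2Space G] [LocallyCompactSpace G]

omit [IsTopologicalAddGroup G] in
theorem exists_le {μ : RadonMeasure G} (hμ : IsTranslationBounded μ) {K : Set G}
    (hK : IsCompact K) : ∃ C : ℝ≥0, ∀ t : G, μ.tv (t +ᵥ K) ≤ C := by
  refine ⟨(⨆ t : G, μ.tv (t +ᵥ K)).toNNReal, fun t => ?_⟩
  rw [ENNReal.coe_toNNReal (hμ K hK).ne]
  exact le_iSup (fun t : G => μ.tv (t +ᵥ K)) t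

variable [SecondCountableTopology G] (θ : Measure G) [θ.IsAddHaarMeasure]

/-- Integrate `1_U(u - t)` over `t ∈ B` and `u ∈ G` in both orders: one gives `|μ|(B) |U|`, the
other is at most `sup_u |μ|(u - V)` times `|B + U|`. Here `U` is the interior of the compact set
`V`: openness makes `B + U` measurable, compactness makes the supremum finite. -/
theorem exists_tv_le {μ : RadonMeasure G} (hμ : IsTranslationBounded μ) :
    ∃ (U V : Set G) (C : ℝ≥0), U ⊆ V ∧ IsCompact V ∧
      ∀ B : Set G, MeasurableSet B → μ.tv B ≤ C * θ (B + U) := by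
  obtain ⟨V, hV, hV0⟩ := exists_compact_mem_nhds (0 : G)
  obtain ⟨D, hD⟩ := hμ.exists_le hV.neg
  have hUo : IsOpen (interior V) := isOpen_interior
  have hUpos : θ (interior V) ≠ 0 :=
    (hUo.measure_pos θ ⟨0, mem_interior_iff_mem_nhds.2 hV0⟩).ne'
  have hUfin : θ (interior V) ≠ ∞ :=
    ((measure_mono interior_subset).trans_lt hV.measure_lt_top).ne
  refine ⟨interior V, V, D / (θ (interior V)).toNNReal, interior_subset, hV, fun B hB => ?_⟩
  have key : μ.tv B * θ (interior V) ≤ D * θ (B + interior V) := by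
    calc μ.tv B * θ (interior V)
        = ∫⁻ t in B, ∫⁻ u, (interior V).indicator 1 (u - t) ∂θ ∂μ.tv := by
          have : ∀ t, ∫⁻ u, (interior V).indicator (1 : G → ℝ≥0∞) (u - t) ∂θ =
              θ (interior V) := fun t => by
            rw [lintegral_sub_right_eq_self, lintegral_indicator_one hUo.measurableSet]
          simp only [this, setLIntegral_const, mul_comm]
      _ = ∫⁻ u, ∫⁻ t in B, (interior V).indicator 1 (u - t) ∂μ.tv ∂θ := by
          refine lintegral_lintegral_swap (Measurable.aemeasurable ?_)
          exact (measurable_one.indicator hUo.measurableSet).comp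
            (measurable_snd.sub measurable_fst)
      _ ≤ ∫⁻ u, (B + interior V).indicator (fun _ => (D : ℝ≥0∞)) u ∂θ := by
          refine lintegral_mono fun u => ?_
          by_cases hu : u ∈ B + interior V
          · rw [Set.indicator_of_mem hu]
            calc ∫⁻ t in B, (interior V).indicator 1 (u - t) ∂μ.tv
                ≤ ∫⁻ t, (u +ᵥ -V).indicator 1 t ∂μ.tv := by
                  refine (setLIntegral_le_lintegral _ _).trans (lintegral_mono fun t => ?_)
                  by_cases ht : u - t ∈ interior V
                  · have : t ∈ u +ᵥ -V := ⟨t - u, by simpa using interior_subset ht, by simp⟩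
                    rw [Set.indicator_of_mem ht, Set.indicator_of_mem this]
                    exact le_rfl
                  · rw [Set.indicator_of_notMem ht]
                    exact zero_le
              _ ≤ D := by
                  rw [lintegral_indicator_one (hV.neg.vadd u).measurableSet]
                  exact hD u
          · rw [Set.indicator_of_notMem hu, le_zero_iff]
            refine setLIntegral_eq_zero hB fun t ht => ?_
            refine Set.indicator_of_notMem (fun h => hu ⟨t, ht, u - t, h, ?_⟩) _
            exact add_sub_cancel t u
      _ = D * θ (B + interior V) := by
          rw [lintegral_indicator_const (hUo.add_left).measurableSet]
  rw [ENNReal.coe_div (by simpa [ENNReal.toNNReal_eq_zero_iff] using ⟨hUpos, hUfin⟩),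
    ENNReal.coe_toNNReal hUfin, ← ENNReal.mul_div_right_comm]
  exact (ENNReal.le_div_iff_mul_le (Or.inl hUpos) (Or.inl hUfin)).2 key

/-- The van Hove condition controls boundaries for Haar measure only; thickening by `U` transfers
this to `|μ|`, since the thickened inner boundary is still contained in a boundary. -/
theorem tv_inter_sub_le {μ : RadonMeasure G} (hμ : IsTranslationBounded μ) {A : ℕ → Set G}
    (hA : IsVanHove θ A) {K : Set G} (hK : IsCompact K) {ε : ℝ≥0} (hε : 0 < ε) :
    ∀ᶠ n in atTop, μ.tv (A n ∩ ((A n)ᶜ - K)) ≤ ε * θ (A n) := by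
  obtain ⟨U, V, C, hUV, hV, hC⟩ := hμ.exists_tv_le θ
  have hC0 : (0 : ℝ≥0∞) < (ε / (C + 1) : ℝ≥0) := by
    rw [ENNReal.coe_pos]; positivity
  filter_upwards [hA.kBoundary_le ((sub_eq_add_neg K V ▸ hK.add hV.neg).union hV) hC0] with n hn
  have hm : MeasurableSet (A n ∩ ((A n)ᶜ - K)) :=
    (hA.isCompact n).measurableSet.inter
      ((hA.isCompact n).isClosed.isOpen_compl.sub_right).measurableSet
  calc μ.tv (A n ∩ ((A n)ᶜ - K)) ≤ C * θ (A n ∩ ((A n)ᶜ - K) + U) := hC _ hm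
    _ ≤ C * ((ε / (C + 1) : ℝ≥0) * θ (A n)) := by
        gcongr
        exact (measure_mono (inter_sub_add_subset_kBoundary hUV)).trans hn
    _ = (C * (ε / (C + 1)) : ℝ≥0) * θ (A n) := by rw [← mul_assoc, ENNReal.coe_mul]
    _ ≤ ε * θ (A n) := by
        gcongr
        rw [mul_div_left_comm]
        exact mul_le_of_le_one_right (by simp) (div_le_one_of_le₀ (by simp) (by simp))

theorem exists_tv_le_mul {μ : RadonMeasure G} (hμ : IsTranslationBounded μ) {A : ℕ → Set G}
    (hA : IsVanHove θ A) : ∃ M : ℝ≥0, ∀ᶠ n in atTop, μ.tv (A n) ≤ M * θ (A n) := by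
  obtain ⟨U, V, C, hUV, hV, hC⟩ := hμ.exists_tv_le θ
  refine ⟨C * 2, ?_⟩
  filter_upwards [hA.kBoundary_le hV zero_lt_one] with n hn
  calc μ.tv (A n) ≤ C * θ (A n + U) := hC _ (hA.isCompact n).measurableSet
    _ ≤ C * (θ (A n) + 1 * θ (A n)) := by
        gcongr
        exact (measure_mono (add_subset_union_kBoundary hUV)).trans
          ((measure_union_le _ _).trans (by gcongr))
    _ = (C * 2 : ℝ≥0) * θ (A n) := by push_cast; ring

end IsTranslationBounded

namespace RadonMeasure

variable {X : Type*} [TopologicalSpace X] [T2Space X] [LocallyCompactSpace X]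
  [SecondCountableTopology X] [MeasurableSpace X] [BorelSpace X] (μ : RadonMeasure X)

theorem enorm_setIntegral_le_mul {A S : Set X} (hA : MeasurableSet A) (hS : MeasurableSet S)
    {f : X → ℂ} {δ : ℝ≥0∞} (h : ∀ x ∈ A, ‖f x‖ₑ ≤ S.indicator (fun _ => δ) x) :
    ‖μ.setIntegral A f‖ₑ ≤ 6 * (δ * μ.tv (S ∩ A)) := by
  refine (μ.enorm_setIntegral_le A f).trans ?_
  gcongr
  refine (setLIntegral_mono' hA h).trans ?_
  rw [lintegral_indicator_const hS, Measure.restrict_apply hS]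

omit [SecondCountableTopology X] in
theorem setIntegral_add_of_continuous {A : Set X} (hA : IsCompact A) {f g : X → ℂ}
    (hf : Continuous f) (hg : Continuous g) :
    μ.setIntegral A (fun x => f x + g x) = μ.setIntegral A f + μ.setIntegral A g :=
  μ.setIntegral_add (fun _ _ => hf.continuousOn.integrableOn_compact hA)
    fun _ _ => hg.continuousOn.integrableOn_compact hA

omit [SecondCountableTopology X] in
theorem setIntegral_sum_mul {ι : Type*} {A : Set X} (hA : IsCompact A) (s : Finset ι) (b : ι → ℂ)
    {g : ι → X → ℂ} (hg : ∀ i, Continuous (g i)) :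
    μ.setIntegral A (fun x => ∑ i ∈ s, b i * g i x) = ∑ i ∈ s, b i * μ.setIntegral A (g i) := by
  classical
  induction s using Finset.induction_on with
  | empty => simp [setIntegral]
  | insert i s hi ih =>
    simp only [Finset.sum_insert hi]
    rw [setIntegral_add_of_continuous μ hA (f := fun x => b i * g i x)
      (g := fun x => ∑ i ∈ s, b i * g i x) (continuous_const.mul (hg i))
      (continuous_finsetSum s fun j _ => continuous_const.mul (hg j)), ih, setIntegral_const_mul]

end RadonMeasure

/-! ### Regularity of `φ * μ` and the effect of truncating `μ` -/

section ConvFun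

variable {G : Type*} [AddCommGroup G] [TopologicalSpace G] [IsTopologicalAddGroup G]

theorem convFun_apply_eq_integral [MeasurableSpace G] [BorelSpace G] [T2Space G]
    [LocallyCompactSpace G] (φ : C_c(G, ℂ)) (μ : RadonMeasure G) (t : G) :
    convFun φ μ t = μ.integral fun s => φ (t - s) :=
  (μ.integral_eq_toFun _).symm

/-- Uniform continuity together with a compact set `L` carrying all the differences for small `u`.
Since `L` does not depend on `δ`, a bound for `|μ|` on its translates can be fixed before `δ` is
chosen. -/
theorem CompactlySupportedContinuousMap.eventually_norm_sub_translate_le [LocallyCompactSpace G]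
    (φ : C_c(G, ℂ)) : ∃ L : Set G, IsCompact L ∧ ∀ δ : ℝ, 0 < δ →
    ∀ᶠ u in 𝓝 (0 : G), ∀ x, ‖φ x - φ (x - u)‖ ≤ δ ∧ (x ∉ L → φ x - φ (x - u) = 0) := by
  obtain ⟨V, hV, hV0⟩ := exists_compact_mem_nhds (0 : G)
  have hL : IsCompact (tsupport φ + V) := IsCompact.add φ.hasCompactSupport hV
  refine ⟨tsupport φ + V, hL, fun δ hδ => ?_⟩
  have hloc : ∀ᶠ u in 𝓝 (0 : G), ∀ x ∈ tsupport φ + V, ‖φ x - φ (x - u)‖ < δ := by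
    refine hL.eventually_forall_of_forall_eventually fun x _ => ?_
    have hc : Continuous fun p : G × G => ‖φ p.2 - φ (p.2 - p.1)‖ := by fun_prop
    have h0 : ‖φ x - φ (x - 0)‖ < δ := by simpa using hδ
    exact hc.continuousAt.eventually_lt_const h0
  filter_upwards [hloc, hV0] with u hu huV x
  have hout : x ∉ tsupport φ + V → φ x - φ (x - u) = 0 := fun hx => by
    have h1 : φ x = 0 := image_eq_zero_of_notMem_tsupport fun h =>
      hx ⟨x, h, 0, mem_of_mem_nhds hV0, add_zero x⟩
    have h2 : φ (x - u) = 0 := image_eq_zero_of_notMem_tsupport fun h =>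
      hx ⟨x - u, h, u, huV, sub_add_cancel x u⟩
    rw [h1, h2, sub_zero]
  refine ⟨?_, hout⟩
  by_cases hx : x ∈ tsupport φ + V
  · exact (hu x hx).le
  · rw [hout hx, norm_zero]
    exact hδ.le

variable [MeasurableSpace G] [BorelSpace G] [T2Space G] [LocallyCompactSpace G]
  [SecondCountableTopology G] {μ : RadonMeasure G}

namespace IsTranslationBounded

/-- The integrand lives on the translate `t - supp φ`. Uniformity in `A` covers both the full
convolution and the part lost by truncation. -/
theorem exists_enorm_setIntegral_le (hμ : IsTranslationBounded μ) (φ : C_c(G, ℂ)) :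
    ∃ C : ℝ≥0, ∀ (A : Set G), MeasurableSet A → ∀ t : G,
      ‖μ.setIntegral A fun s => φ (t - s)‖ₑ ≤ C := by
  have hK : IsCompact (-tsupport φ) := IsCompact.neg φ.hasCompactSupport
  obtain ⟨D, hD⟩ := hμ.exists_le hK
  obtain ⟨M, hM⟩ := φ.continuous.bounded_above_of_compact_support φ.hasCompactSupport
  refine ⟨6 * (M.toNNReal * D), fun A hA t => ?_⟩
  have hb : ∀ x ∈ A, ‖φ (t - x)‖ₑ ≤
      (t +ᵥ -tsupport φ).indicator (fun _ => (M.toNNReal : ℝ≥0∞)) x := fun x _ => by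
    by_cases hx : t - x ∈ tsupport φ
    · have : x ∈ t +ᵥ -tsupport φ := ⟨x - t, by simpa using hx, by simp⟩
      rw [Set.indicator_of_mem this, enorm_le_coe, ← norm_toNNReal]
      exact Real.toNNReal_le_toNNReal (hM _)
    · rw [image_eq_zero_of_notMem_tsupport hx]
      simp
  refine (μ.enorm_setIntegral_le_mul hA (hK.vadd t).measurableSet hb).trans ?_
  push_cast
  gcongr
  exact (measure_mono Set.inter_subset_left).trans (hD t)

theorem exists_enorm_convFun_le (hμ : IsTranslationBounded μ) (φ : C_c(G, ℂ)) :
    ∃ C : ℝ≥0, ∀ t : G, ‖convFun φ μ t‖ₑ ≤ C := by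
  obtain ⟨C, hC⟩ := hμ.exists_enorm_setIntegral_le φ
  refine ⟨C, fun t => ?_⟩
  rw [convFun_apply_eq_integral]
  exact hC _ MeasurableSet.univ t

theorem eventually_enorm_convFun_sub_le (hμ : IsTranslationBounded μ) (φ : C_c(G, ℂ)) {δ : ℝ≥0}
    (hδ : 0 < δ) : ∀ᶠ u in 𝓝 (0 : G), ∀ t, ‖convFun φ μ t - convFun φ μ (t - u)‖ₑ ≤ δ := by
  obtain ⟨L, hL, h⟩ := φ.eventually_norm_sub_translate_le
  obtain ⟨D, hD⟩ := hμ.exists_le hL.neg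
  set η : ℝ≥0 := δ / (6 * D + 1) with hη
  have hη0 : 0 < η := by positivity
  filter_upwards [h η (by exact_mod_cast hη0)] with u hu t
  have heq : convFun φ μ t - convFun φ μ (t - u) =
      μ.integral (reflectTranslate φ t - reflectTranslate φ (t - u) : C_c(G, ℂ)) := by
    rw [μ.integral_eq_toFun, map_sub]
    rfl
  have hb : ∀ x ∈ Set.univ,
      ‖(reflectTranslate φ t - reflectTranslate φ (t - u) : C_c(G, ℂ)) x‖ₑ ≤
        (t +ᵥ -L).indicator (fun _ => (η : ℝ≥0∞)) x := fun x _ => by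
    have hx : (reflectTranslate φ t - reflectTranslate φ (t - u) : C_c(G, ℂ)) x =
        φ (t - x) - φ (t - x - u) := by
      rw [sub_right_comm]
      rfl
    obtain ⟨h1, h2⟩ := hu (t - x)
    rw [hx]
    by_cases hxL : t - x ∈ L
    · have : x ∈ t +ᵥ -L := ⟨x - t, by simpa using hxL, by simp⟩
      rw [Set.indicator_of_mem this, enorm_le_coe]
      exact_mod_cast h1
    · rw [h2 hxL]
      simp
  rw [heq]
  refine (μ.enorm_setIntegral_le_mul MeasurableSet.univ (hL.neg.vadd t).measurableSet hb).trans ?_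
  calc 6 * (η * μ.tv ((t +ᵥ -L) ∩ Set.univ)) ≤ 6 * (η * D) := by
        gcongr
        exact (measure_mono Set.inter_subset_left).trans (hD t)
    _ = (6 * (η * D) : ℝ≥0) := by push_cast; rfl
    _ ≤ δ := by
        rw [ENNReal.coe_le_coe, hη]
        calc 6 * (δ / (6 * D + 1) * D) = δ * (6 * D / (6 * D + 1)) := by ring
          _ ≤ δ := mul_le_of_le_one_right (by simp) (div_le_one_of_le₀ (by simp) (by simp))

theorem continuous_convFun (hμ : IsTranslationBounded μ) (φ : C_c(G, ℂ)) :
    Continuous (convFun φ μ) := by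
  rw [continuous_iff_continuousAt]
  intro t
  rw [ContinuousAt, tendsto_iff_edist_tendsto_0, ENNReal.tendsto_nhds_zero]
  intro ε hε
  obtain ⟨δ, hδ, hδε⟩ := ENNReal.lt_iff_exists_nnreal_btwn.1 hε
  have h1 : Tendsto (fun x : G => t - x) (𝓝 t) (𝓝 0) := by
    have : Continuous fun x : G => t - x := by fun_prop
    simpa using this.tendsto t
  filter_upwards [h1.eventually (hμ.eventually_enorm_convFun_sub_le φ (ENNReal.coe_pos.1 hδ))]
    with x hx
  have := hx t
  rw [sub_sub_cancel] at this
  rw [edist_comm, edist_eq_enorm_sub]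
  exact this.trans hδε.le

/-- Replacing `φ * μ` by the truncated convolution on `A` changes it only near the boundary. -/
theorem exists_enorm_convFun_sub_setIntegral_le (hμ : IsTranslationBounded μ) (φ : C_c(G, ℂ)) :
    ∃ C : ℝ≥0, ∀ A : Set G, MeasurableSet A → ∀ t,
      ‖(μ.setIntegral A fun s => φ (t - s)) - convFun φ μ t‖ₑ ≤
        (Aᶜ - -tsupport φ).indicator (fun _ => (C : ℝ≥0∞)) t := by
  obtain ⟨C, hC⟩ := hμ.exists_enorm_setIntegral_le φ
  refine ⟨C, fun A hA t => ?_⟩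
  have hsplit := μ.integral_eq_add_compl hA (reflectTranslate φ t)
  have h : (μ.setIntegral A fun s => φ (t - s)) - convFun φ μ t =
      -μ.setIntegral Aᶜ fun s => φ (t - s) := by
    rw [convFun, ← μ.integral_eq_toFun, hsplit, ← sub_sub]
    exact sub_eq_neg_self.2 (sub_self _)
  rw [h, enorm_neg]
  by_cases ht : t ∈ Aᶜ - -tsupport φ
  · rw [Set.indicator_of_mem ht]
    exact hC _ hA.compl t
  · have h0 : μ.setIntegral Aᶜ (fun s => φ (t - s)) = μ.setIntegral Aᶜ fun _ => 0 := by
      refine μ.setIntegral_congr hA.compl fun s hs => ?_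
      refine image_eq_zero_of_notMem_tsupport fun h => ht ⟨s, hs, -(t - s), ?_, ?_⟩
      · simpa using h
      · change s - -(t - s) = t
        abel
    rw [h0]
    simp [RadonMeasure.setIntegral]

end IsTranslationBounded

end ConvFun

/-! ### Characters, trigonometric polynomials and smoothing by `ψ ∈ C_c` -/

section Smoothing

variable {G : Type*} [AddCommGroup G] [TopologicalSpace G]

theorem continuous_charEval (χ : DualGroup G) : Continuous (charEval χ) := by
  have h : Continuous fun t : G => χ (Multiplicative.ofAdd t) :=
    χ.continuous_toFun.comp continuous_ofAdd
  exact continuous_subtype_val.comp h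

theorem enorm_charEval (χ : DualGroup G) (t : G) : ‖charEval χ t‖ₑ = 1 := by
  rw [← ofReal_norm, charEval, Circle.norm_coe, ENNReal.ofReal_one]

theorem charEval_sub (χ : DualGroup G) (t u : G) :
    charEval χ (t - u) = charEval χ t * conj (charEval χ u) := by
  rw [charEval, ofAdd_sub, map_div, Circle.coe_div, div_eq_mul_inv, ← Circle.coe_inv,
    Circle.coe_inv_eq_conj]
  rfl

theorem continuous_trigPoly (c : DualGroup G →₀ ℂ) : Continuous (trigPoly c : G → ℂ) :=
  continuous_finsetSum _ fun χ _ => continuous_const.mul (continuous_charEval χ)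

theorem enorm_trigPoly_le (c : DualGroup G →₀ ℂ) (t : G) :
    ‖trigPoly c t‖ₑ ≤ (∑ χ ∈ c.support, ‖c χ‖₊ : ℝ≥0) := by
  rw [ENNReal.ofNNReal_finsetSum]
  refine (enorm_sum_le _ _).trans (Finset.sum_le_sum fun χ _ => ?_)
  rw [enorm_mul, enorm_charEval, mul_one]
  exact le_rfl

variable [IsTopologicalAddGroup G] [MeasurableSpace G]

/-- The convolution `ψ * f`, for `ψ ∈ C_c` and a function `f`. -/
def smoothing (θ : Measure G) (ψ : C_c(G, ℂ)) (f : G → ℂ) (t : G) : ℂ :=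
  ∫ u, ψ u * f (t - u) ∂θ

variable [BorelSpace G] (θ : Measure G)

theorem integrable_smoothing [IsFiniteMeasureOnCompacts θ] (ψ : C_c(G, ℂ)) {f : G → ℂ}
    (hf : Continuous f) (t : G) : Integrable (fun u => ψ u * f (t - u)) θ :=
  Continuous.integrable_of_hasCompactSupport (by fun_prop) ψ.hasCompactSupport.mul_right

theorem smoothing_sub [IsFiniteMeasureOnCompacts θ] (ψ : C_c(G, ℂ)) {f g : G → ℂ}
    (hf : Continuous f) (hg : Continuous g) (t : G) :
    smoothing θ ψ (fun s => f s - g s) t = smoothing θ ψ f t - smoothing θ ψ g t := by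
  simp only [smoothing, mul_sub]
  exact integral_sub (integrable_smoothing θ ψ hf t) (integrable_smoothing θ ψ hg t)

omit [IsTopologicalAddGroup G] in
-- Characters are eigenfunctions of convolution, so smoothing only rescales the coefficients.
theorem smoothing_trigPoly [IsFiniteMeasureOnCompacts θ] (ψ : C_c(G, ℂ)) (c : DualGroup G →₀ ℂ)
    (t : G) : smoothing θ ψ (trigPoly c) t =
      ∑ χ ∈ c.support, (c χ * ∫ u, ψ u * conj (charEval χ u) ∂θ) * charEval χ t := by
  have h : ∀ u, ψ u * trigPoly c (t - u) =
      ∑ χ ∈ c.support, (c χ * charEval χ t) * (ψ u * conj (charEval χ u)) := fun u => by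
    rw [trigPoly, Finsupp.sum, Finset.mul_sum]
    refine Finset.sum_congr rfl fun χ _ => ?_
    rw [charEval_sub]
    ring
  simp only [smoothing, h]
  rw [integral_finsetSum]
  · refine Finset.sum_congr rfl fun χ _ => ?_
    rw [integral_const_mul]
    ring
  · intro χ _
    have hχ := continuous_charEval χ
    exact (Continuous.integrable_of_hasCompactSupport (by fun_prop)
      ψ.hasCompactSupport.mul_right).const_mul _

/-- As `∫ ψ = 1`, the difference is the `ψ`-weighted integral of `f(t) - f(t - u)`, and the weight
has total mass `1`. -/
theorem enorm_sub_smoothing_le [IsFiniteMeasureOnCompacts θ] {ψ : C_c(G, ℂ)}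
    (h1 : ∫ u, ψ u ∂θ = 1) (h2 : ∫⁻ u, ‖ψ u‖ₑ ∂θ = 1) {f : G → ℂ} (hf : Continuous f)
    {δ : ℝ≥0∞} {t : G} (hδ : ∀ u, ψ u ≠ 0 → ‖f t - f (t - u)‖ₑ ≤ δ) :
    ‖f t - smoothing θ ψ f t‖ₑ ≤ δ := by
  have heq : f t - smoothing θ ψ f t = ∫ u, ψ u * (f t - f (t - u)) ∂θ := by
    simp only [mul_sub]
    rw [integral_sub _ (integrable_smoothing θ ψ hf t), integral_mul_const, h1, one_mul]
    · rfl
    · exact (ψ.continuous.integrable_of_hasCompactSupport ψ.hasCompactSupport).mul_const _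
  rw [heq]
  calc ‖∫ u, ψ u * (f t - f (t - u)) ∂θ‖ₑ ≤ ∫⁻ u, ‖ψ u * (f t - f (t - u))‖ₑ ∂θ :=
        enorm_integral_le_lintegral_enorm _
    _ ≤ ∫⁻ u, ‖ψ u‖ₑ * δ ∂θ := by
        refine lintegral_mono fun u => ?_
        rw [enorm_mul]
        by_cases hu : ψ u = 0
        · simp [hu]
        · gcongr
          exact hδ u hu
    _ = δ := by
        rw [lintegral_mul_const _ (map_continuous ψ).measurable.enorm, h2, one_mul]

variable [T2Space G] [LocallyCompactSpace G]

omit [T2Space G] in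
-- A Urysohn bump at `0`, divided by its integral; nonnegativity makes its `L¹` norm equal to its
-- integral.
theorem exists_approximate_identity [θ.IsAddHaarMeasure] {W : Set G} (hW : W ∈ 𝓝 (0 : G)) :
    ∃ ψ : C_c(G, ℂ), ∫ u, ψ u ∂θ = 1 ∧ ∫⁻ u, ‖ψ u‖ₑ ∂θ = 1 ∧ ∀ u, ψ u ≠ 0 → u ∈ W := by
  obtain ⟨f, hf1, hf2, hf3, hf4⟩ := exists_continuousMap_one_of_isCompact_subset_isOpen
    (isCompact_singleton (x := (0 : G))) isOpen_interior
    (Set.singleton_subset_iff.2 (mem_interior_iff_mem_nhds.2 hW))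
  have hint : Integrable f θ := f.continuous.integrable_of_hasCompactSupport hf2
  have hpos : 0 < ∫ u, f u ∂θ :=
    f.continuous.integral_pos_of_hasCompactSupport_nonneg_nonzero hf2 (fun x => (hf4 x).1)
      (x := 0) (by rw [hf1 rfl]; simp)
  have hn : ∀ u, ‖(((f u / ∫ u, f u ∂θ : ℝ)) : ℂ)‖ = f u / ∫ u, f u ∂θ := fun u => by
    rw [Complex.norm_real]
    exact Real.norm_of_nonneg (div_nonneg (hf4 u).1 hpos.le)
  have hI : ∫ u, f u / (∫ u, f u ∂θ) ∂θ = 1 := by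
    rw [integral_div, div_self hpos.ne']
  let ψ : C_c(G, ℂ) :=
    { toFun := fun u => ((f u / ∫ u, f u ∂θ : ℝ) : ℂ)
      continuous_toFun := by fun_prop
      hasCompactSupport' := HasCompactSupport.comp_left (f := f)
        (g := fun r : ℝ => ((r / ∫ u, f u ∂θ : ℝ) : ℂ)) hf2 (by simp) }
  have hψ : ∀ u, ψ u = ((f u / ∫ u, f u ∂θ : ℝ) : ℂ) := fun _ => rfl
  refine ⟨ψ, ?_, ?_, fun u hu => ?_⟩
  · simp only [hψ]
    rw [integral_complex_ofReal, hI, Complex.ofReal_one]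
  · rw [← ofReal_integral_norm_eq_lintegral_enorm
      ((map_continuous ψ).integrable_of_hasCompactSupport ψ.hasCompactSupport)]
    simp only [hψ, hn]
    rw [hI, ENNReal.ofReal_one]
  · refine interior_subset (hf3 (subset_tsupport _ fun h => hu ?_))
    rw [hψ, h]
    simp

variable [SecondCountableTopology G]

theorem continuous_smoothing [IsFiniteMeasureOnCompacts θ] (ψ : C_c(G, ℂ)) {f : G → ℂ}
    (hf : Continuous f) : Continuous (smoothing θ ψ f) := by
  have h : smoothing θ ψ f = fun t => ∫ u in tsupport ψ, ψ u * f (t - u) ∂θ := by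
    ext t
    refine (setIntegral_eq_integral_of_forall_compl_eq_zero fun u hu => ?_).symm
    rw [image_eq_zero_of_notMem_tsupport hu, zero_mul]
  rw [h]
  exact continuous_parametric_integral_of_continuous
    (by simp only [Function.uncurry_def]; fun_prop) ψ.hasCompactSupport

/-- After Fubini, `|f(u)|` is weighted by `∫_A |ψ(t - u)| d|ν|(t)`, which is at most `sup |ψ|` times
`|ν|(u + supp ψ)` and vanishes unless `u ∈ A - W`. The constant is independent of `f` and `A`, so
`f` may be chosen after `ψ`. -/
theorem IsTranslationBounded.exists_lintegral_smoothing_le [θ.IsAddHaarMeasure]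
    {ν : RadonMeasure G} (hν : IsTranslationBounded ν) {ψ : C_c(G, ℂ)} {W : Set G}
    (hW : IsOpen W) (hψW : ∀ u, ψ u ≠ 0 → u ∈ W) :
    ∃ C : ℝ≥0, ∀ (A : Set G), MeasurableSet A → ∀ f : G → ℂ, Continuous f →
      ∫⁻ t in A, ‖smoothing θ ψ f t‖ₑ ∂ν.tv ≤ C * ∫⁻ u in A - W, ‖f u‖ₑ ∂θ := by
  have hK : IsCompact (tsupport ψ) := ψ.hasCompactSupport
  obtain ⟨D, hD⟩ := hν.exists_le hK
  obtain ⟨M, hM⟩ := ψ.continuous.bounded_above_of_compact_support ψ.hasCompactSupport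
  refine ⟨M.toNNReal * D, fun A hA f hf => ?_⟩
  have hψe : ∀ u, ‖ψ u‖ₑ ≤ (M.toNNReal : ℝ≥0∞) := fun u => by
    rw [enorm_le_coe, ← norm_toNNReal]
    exact Real.toNNReal_le_toNNReal (hM _)
  have hpt : ∀ t, ‖smoothing θ ψ f t‖ₑ ≤ ∫⁻ u, ‖ψ (t - u)‖ₑ * ‖f u‖ₑ ∂θ := fun t => by
    refine (enorm_integral_le_lintegral_enorm _).trans (le_of_eq ?_)
    rw [← lintegral_sub_left_eq_self (fun u => ‖ψ (t - u)‖ₑ * ‖f u‖ₑ) t]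
    simp only [sub_sub_cancel, enorm_mul]
  have hin : ∀ u, ∫⁻ t in A, ‖ψ (t - u)‖ₑ * ‖f u‖ₑ ∂ν.tv ≤
      (A - W).indicator (fun u => (M.toNNReal * D : ℝ≥0) * ‖f u‖ₑ) u := fun u => by
    by_cases hu : u ∈ A - W
    · rw [Set.indicator_of_mem hu, lintegral_mul_const _ (by
        have : Continuous fun t => ψ (t - u) := by fun_prop
        exact this.measurable.enorm)]
      gcongr
      calc ∫⁻ t in A, ‖ψ (t - u)‖ₑ ∂ν.tv
          ≤ ∫⁻ t, (u +ᵥ tsupport ψ).indicator (fun _ => (M.toNNReal : ℝ≥0∞)) t ∂ν.tv := by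
            refine (setLIntegral_le_lintegral _ _).trans (lintegral_mono fun t => ?_)
            by_cases ht : t - u ∈ tsupport ψ
            · have : t ∈ u +ᵥ tsupport ψ := ⟨t - u, ht, by simp⟩
              rw [Set.indicator_of_mem this]
              exact hψe _
            · rw [image_eq_zero_of_notMem_tsupport ht]
              simp
        _ = M.toNNReal * ν.tv (u +ᵥ tsupport ψ) :=
            lintegral_indicator_const (hK.vadd u).measurableSet _
        _ ≤ (M.toNNReal * D : ℝ≥0) := by
            push_cast
            gcongr
            exact hD u
    · rw [Set.indicator_of_notMem hu, le_zero_iff]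
      refine setLIntegral_eq_zero hA fun t ht => ?_
      have : ψ (t - u) = 0 := by
        by_contra h
        exact hu ⟨t, ht, t - u, hψW _ h, sub_sub_cancel t u⟩
      simp [this]
  calc ∫⁻ t in A, ‖smoothing θ ψ f t‖ₑ ∂ν.tv
      ≤ ∫⁻ t in A, ∫⁻ u, ‖ψ (t - u)‖ₑ * ‖f u‖ₑ ∂θ ∂ν.tv := lintegral_mono hpt
    _ = ∫⁻ u, ∫⁻ t in A, ‖ψ (t - u)‖ₑ * ‖f u‖ₑ ∂ν.tv ∂θ := by
        have h1 : Continuous fun p : G × G => ψ (p.1 - p.2) := by fun_prop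
        have h2 : Continuous fun p : G × G => f p.2 := by fun_prop
        exact lintegral_lintegral_swap (h1.measurable.enorm.mul h2.measurable.enorm).aemeasurable
    _ ≤ ∫⁻ u, (A - W).indicator (fun u => (M.toNNReal * D : ℝ≥0) * ‖f u‖ₑ) u ∂θ :=
        lintegral_mono hin
    _ = _ := by
        rw [lintegral_indicator (hW.sub_left).measurableSet,
          lintegral_const_mul _ hf.measurable.enorm]

end Smoothing

/-! ### Means along the van Hove sequence and orthogonality -/

section Means

variable {G : Type*} [AddCommGroup G] [TopologicalSpace G] [MeasurableSpace G] {θ : Measure G}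
  {A : ℕ → Set G}

theorem IsVanHove.tendsto_inv_mul_iff [IsFiniteMeasureOnCompacts θ] (hA : IsVanHove θ A)
    (z : ℕ → ℂ) :
    Tendsto (fun n => ((θ.real (A n) : ℂ))⁻¹ * z n) atTop (𝓝 0) ↔
      ∀ ε : ℝ≥0, 0 < ε → ∀ᶠ n in atTop, ‖z n‖ₑ ≤ ε * θ (A n) := by
  have he : ∀ n, ‖((θ.real (A n) : ℂ))⁻¹ * z n‖ₑ = ‖z n‖ₑ / θ (A n) := fun n => by
    have h0 := (hA.measure_pos n).ne'
    have h1 := (hA.isCompact n).measure_lt_top (μ := θ).ne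
    have h2 : θ.real (A n) ≠ 0 := (measureReal_ne_zero_iff h1).2 h0
    rw [enorm_mul, enorm_inv (by exact_mod_cast h2), ← ofReal_norm (θ.real (A n) : ℂ),
      Complex.norm_real, Real.norm_of_nonneg measureReal_nonneg, ofReal_measureReal h1, mul_comm,
      ENNReal.div_eq_inv_mul, mul_comm]
  have hd : ∀ (ε : ℝ≥0∞) n, ‖z n‖ₑ / θ (A n) ≤ ε ↔ ‖z n‖ₑ ≤ ε * θ (A n) := fun ε n =>
    ENNReal.div_le_iff (hA.measure_pos n).ne' (hA.isCompact n).measure_lt_top.ne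
  rw [tendsto_iff_edist_tendsto_0, ENNReal.tendsto_nhds_zero]
  simp only [edist_zero_right, he, hd]
  refine ⟨fun h ε hε => h ε (ENNReal.coe_pos.2 hε), fun h ε hε => ?_⟩
  obtain ⟨δ, hδ, hδε⟩ := ENNReal.lt_iff_exists_nnreal_btwn.1 hε
  filter_upwards [h δ (ENNReal.coe_pos.1 hδ)] with n hn
  exact hn.trans (by gcongr)

theorem IsVanHove.setLIntegral_le_of_besicovitchSeminorm_lt [IsFiniteMeasureOnCompacts θ]
    (hA : IsVanHove θ A) {f : G → ℂ} {ε : ℝ≥0∞} (h : besicovitchSeminorm θ A f < ε) :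
    ∀ᶠ n in atTop, ∫⁻ t in A n, ‖f t‖ₑ ∂θ ≤ ε * θ (A n) := by
  filter_upwards [eventually_lt_of_limsup_lt h] with n hn
  exact (ENNReal.div_le_iff (hA.measure_pos n).ne' (hA.isCompact n).measure_lt_top.ne).1 hn.le

variable [IsTopologicalAddGroup G] [BorelSpace G] [T2Space G] [LocallyCompactSpace G]
  [SecondCountableTopology G] [θ.IsAddHaarMeasure]

omit [BorelSpace G] [T2Space G] [LocallyCompactSpace G] [SecondCountableTopology G] in
-- Enlarging `A_n` to `A_n - W` adds only boundary, where the bounded `h` contributes at most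
-- another `ε |A_n|`.
theorem IsVanHove.setLIntegral_sub_le (hA : IsVanHove θ A) {h : G → ℂ} {D : ℝ≥0}
    (hD : ∀ t, ‖h t‖ₑ ≤ D) {ε : ℝ≥0} (hε : 0 < ε)
    (hmean : ∀ᶠ n in atTop, ∫⁻ t in A n, ‖h t‖ₑ ∂θ ≤ ε * θ (A n)) {W V : Set G} (hWV : W ⊆ V)
    (hV : IsCompact V) :
    ∀ᶠ n in atTop, ∫⁻ u in A n - W, ‖h u‖ₑ ∂θ ≤ 2 * ε * θ (A n) := by
  have hη : (0 : ℝ≥0∞) < (ε / (D + 1) : ℝ≥0) := ENNReal.coe_pos.2 (by positivity)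
  filter_upwards [hmean, hA.kBoundary_le hV.neg hη] with n h1 h2
  have hsub : A n - W ⊆ A n ∪ kBoundary (-V) (A n) := by
    rw [sub_eq_add_neg]
    exact add_subset_union_kBoundary (Set.neg_subset_neg.2 hWV)
  calc ∫⁻ u in A n - W, ‖h u‖ₑ ∂θ ≤ ∫⁻ u in A n ∪ kBoundary (-V) (A n), ‖h u‖ₑ ∂θ :=
        lintegral_mono_set hsub
    _ ≤ (∫⁻ u in A n, ‖h u‖ₑ ∂θ) + ∫⁻ u in kBoundary (-V) (A n), ‖h u‖ₑ ∂θ :=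
        lintegral_union_le _ _ _
    _ ≤ ε * θ (A n) + D * ((ε / (D + 1) : ℝ≥0) * θ (A n)) := by
        gcongr
        refine (lintegral_mono (g := fun _ => (D : ℝ≥0∞)) hD).trans ?_
        rw [setLIntegral_const]
        gcongr
    _ ≤ ε * θ (A n) + ε * θ (A n) := by
        refine add_le_add le_rfl ?_
        rw [← mul_assoc, ← ENNReal.coe_mul, mul_div_left_comm]
        refine mul_le_mul' (ENNReal.coe_le_coe.2 ?_) le_rfl
        exact mul_le_of_le_one_right (by simp) (div_le_one_of_le₀ (by simp) (by simp))
    _ = 2 * ε * θ (A n) := by ring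

variable {ν : RadonMeasure G}

omit [IsTopologicalAddGroup G] in
-- The smoothed polynomial has fixed, finitely many frequencies, so its mean against `ν` is a finite
-- combination of sequences tending to `0`.
theorem enorm_setIntegral_conj_trigPoly_le (hA : IsVanHove θ A)
    (hFB : ∀ χ, IsFourierBohrCoeff θ A ν χ 0) (ψ : C_c(G, ℂ)) (c : DualGroup G →₀ ℂ) {ε : ℝ≥0}
    (hε : 0 < ε) : ∀ᶠ n in atTop,
      ‖ν.setIntegral (A n) fun t => conj (smoothing θ ψ (trigPoly c) t)‖ₑ ≤ ε * θ (A n) := by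
  set b : DualGroup G → ℂ := fun χ => conj (c χ * ∫ u, ψ u * conj (charEval χ u) ∂θ) with hb
  have heq : ∀ n, (ν.setIntegral (A n) fun t => conj (smoothing θ ψ (trigPoly c) t)) =
      ∑ χ ∈ c.support, b χ * ν.setIntegral (A n) fun t => conj (charEval χ t) := fun n => by
    rw [← ν.setIntegral_sum_mul (hA.isCompact n) c.support b
      (g := fun χ t => conj (charEval χ t)) fun χ =>
        Complex.continuous_conj.comp (continuous_charEval χ)]
    simp only [smoothing_trigPoly, map_sum, map_mul, hb]
  refine (hA.tendsto_inv_mul_iff _).1 ?_ ε hε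
  have hlim : Tendsto (fun n => ∑ χ ∈ c.support, b χ * ((θ.real (A n) : ℂ)⁻¹ *
      ν.setIntegral (A n) fun t => conj (charEval χ t))) atTop
      (𝓝 (∑ χ ∈ c.support, b χ * 0)) :=
    tendsto_finsetSum _ fun χ _ => (hFB χ).const_mul (b χ)
  simp only [mul_zero, Finset.sum_const_zero] at hlim
  refine hlim.congr fun n => ?_
  rw [heq, Finset.mul_sum]
  exact Finset.sum_congr rfl fun χ _ => by ring

/-- If all Fourier–Bohr coefficients of `ν` vanish, then every bounded uniformly continuous
Besicovitch almost periodic function is orthogonal to `ν` in the mean. -/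
theorem IsBesicovitchAPFun.enorm_setIntegral_conj_le (hA : IsVanHove θ A)
    (hν : IsTranslationBounded ν) (hFB : ∀ χ, IsFourierBohrCoeff θ A ν χ 0) {f : G → ℂ}
    (hf : Continuous f) {C : ℝ≥0} (hC : ∀ t, ‖f t‖ₑ ≤ C)
    (huc : ∀ δ : ℝ≥0, 0 < δ → ∀ᶠ u in 𝓝 (0 : G), ∀ t, ‖f t - f (t - u)‖ₑ ≤ δ)
    (hAP : IsBesicovitchAPFun θ A f) {ε : ℝ≥0} (hε : 0 < ε) :
    ∀ᶠ n in atTop, ‖ν.setIntegral (A n) fun t => conj (f t)‖ₑ ≤ ε * θ (A n) := by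
  obtain ⟨M, hM⟩ := hν.exists_tv_le_mul θ hA
  obtain ⟨V, hV, hV0⟩ := exists_compact_mem_nhds (0 : G)
  -- Chosen so that `6 δ M ≤ ε / 3`. The order of choices matters: `δ` from `M`, then `ψ` from `δ`,
  -- then `D` from `ψ`, and only then the polynomial.
  have hδ : 0 < ε / (18 * (M + 1)) := by positivity
  set δ := ε / (18 * (M + 1)) with hδdef
  set W : Set G := interior ({u | ∀ t, ‖f t - f (t - u)‖ₑ ≤ δ} ∩ V) with hWdef
  have hW0 : W ∈ 𝓝 (0 : G) := interior_mem_nhds.2 (inter_mem (huc δ hδ) hV0)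
  obtain ⟨ψ, hψ1, hψ2, hψW⟩ := exists_approximate_identity θ hW0
  have hWV : W ⊆ V := interior_subset.trans Set.inter_subset_right
  obtain ⟨D, hD⟩ := hν.exists_lintegral_smoothing_le θ isOpen_interior hψW
  -- Chosen so that `6 D (2 ε') ≤ ε / 3`; the factor `2` comes from enlarging `A_n` to `A_n - W`.
  have hε' : 0 < ε / (36 * (D + 1)) := by positivity
  set ε' := ε / (36 * (D + 1)) with hε'def
  obtain ⟨c, hc⟩ := hAP ε' (ENNReal.coe_pos.2 hε')
  have hP : Continuous (trigPoly c : G → ℂ) := continuous_trigPoly c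
  have hh : Continuous fun t => f t - trigPoly c t := hf.sub hP
  have hhb : ∀ t, ‖f t - trigPoly c t‖ₑ ≤ (C + ∑ χ ∈ c.support, ‖c χ‖₊ : ℝ≥0) := fun t => by
    rw [ENNReal.coe_add]
    exact enorm_sub_le.trans (add_le_add (hC t) (enorm_trigPoly_le c t))
  have hε3 : 0 < ε / 3 := by positivity
  filter_upwards [hM, hA.setLIntegral_sub_le hhb hε'
    (hA.setLIntegral_le_of_besicovitchSeminorm_lt hc) hWV hV,
    enorm_setIntegral_conj_trigPoly_le hA hFB ψ c hε3] with n h1 h2 h3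
  have hAm := (hA.isCompact n).measurableSet
  have hcf := continuous_smoothing θ ψ hf
  have hch := continuous_smoothing θ ψ hh
  have hcP := continuous_smoothing θ ψ hP
  -- The splitting `f = (f - ψ * f) + ψ * (f - P) + ψ * P`, each term costing `ε / 3`.
  have hdec : (ν.setIntegral (A n) fun t => conj (f t)) =
      (ν.setIntegral (A n) fun t => conj (f t - smoothing θ ψ f t)) +
      ((ν.setIntegral (A n) fun t => conj (smoothing θ ψ (fun s => f s - trigPoly c s) t)) +
        ν.setIntegral (A n) fun t => conj (smoothing θ ψ (trigPoly c) t)) := by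
    rw [← ν.setIntegral_add_of_continuous (hA.isCompact n) (by fun_prop) (by fun_prop),
      ← ν.setIntegral_add_of_continuous (hA.isCompact n) (by fun_prop) (by fun_prop)]
    refine congrArg (ν.setIntegral (A n)) (funext fun t => ?_)
    rw [smoothing_sub θ ψ hf hP, ← map_add, ← map_add]
    ring_nf
  have e1 : ‖ν.setIntegral (A n) fun t => conj (f t - smoothing θ ψ f t)‖ₑ ≤
      (ε / 3 : ℝ≥0) * θ (A n) := by
    refine (ν.enorm_setIntegral_le_mul hAm MeasurableSet.univ (δ := δ) fun t _ => ?_).trans ?_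
    · rw [Set.indicator_univ, RCLike.enorm_conj]
      exact enorm_sub_smoothing_le θ hψ1 hψ2 hf fun u hu => (interior_subset (hψW u hu)).1 t
    · rw [Set.univ_inter]
      calc 6 * (δ * ν.tv (A n)) ≤ 6 * (δ * (M * θ (A n))) := by gcongr
        _ = (6 * (δ * M) : ℝ≥0) * θ (A n) := by push_cast; ring
        _ ≤ (ε / 3 : ℝ≥0) * θ (A n) := by
            gcongr
            calc 6 * (δ * M) ≤ 6 * (δ * (M + 1)) := by gcongr; simp
              _ = ε / 3 := by rw [hδdef]; field_simp; norm_num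
  have e2 : ‖ν.setIntegral (A n) fun t =>
      conj (smoothing θ ψ (fun s => f s - trigPoly c s) t)‖ₑ ≤ (ε / 3 : ℝ≥0) * θ (A n) := by
    refine (ν.enorm_setIntegral_le _ _).trans ?_
    simp only [RCLike.enorm_conj]
    calc 6 * ∫⁻ t in A n, ‖smoothing θ ψ (fun s => f s - trigPoly c s) t‖ₑ ∂ν.tv
        ≤ 6 * (D * (2 * ε' * θ (A n))) := by
          gcongr
          refine (hD (A n) hAm _ hh).trans ?_
          gcongr
      _ = (6 * (D * (2 * ε')) : ℝ≥0) * θ (A n) := by push_cast; ring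
      _ ≤ (ε / 3 : ℝ≥0) * θ (A n) := by
          gcongr
          calc 6 * (D * (2 * ε')) ≤ 6 * ((D + 1) * (2 * ε')) := by gcongr; simp
            _ = ε / 3 := by rw [hε'def]; field_simp; norm_num
  rw [hdec]
  calc _ ≤ (ε / 3 : ℝ≥0) * θ (A n) + ((ε / 3 : ℝ≥0) * θ (A n) + (ε / 3 : ℝ≥0) * θ (A n)) :=
        (enorm_add_le _ _).trans (add_le_add e1 ((enorm_add_le _ _).trans (add_le_add e2 h3)))
    _ = (ε / 3 + (ε / 3 + ε / 3) : ℝ≥0) * θ (A n) := by push_cast; ring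
    _ = ε * θ (A n) := by
        congr 2
        field_simp
        norm_num

/-- Up to a boundary error, the approximants are means of `conj (φ' * μ)` against `ν`, and these
tend to `0` by the orthogonality of `ν` to Besicovitch almost periodic functions. -/
theorem isEberleinConv_tilde_zero (hA : IsVanHove θ A) {μ : RadonMeasure G}
    (hμ : IsTranslationBounded μ) (hν : IsTranslationBounded ν) (hμA : IsBesicovitchAP θ A μ)
    (hFB : ∀ χ, IsFourierBohrCoeff θ A ν χ 0) : IsEberleinConv θ A μ ν.tilde 0 := by
  intro φ
  refine (hA.tendsto_inv_mul_iff _).2 fun ε hε => ?_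
  -- The reflection `φ'(x) = φ(-x)` turns `φ(s - t)` into the convolution kernel `φ'(t - s)`.
  set φ' := reflectTranslate φ 0 with hφ'
  have hφ'e : ∀ s t, φ (s - t) = φ' (t - s) := fun s t => by
    change φ (s - t) = φ (0 - (t - s))
    rw [zero_sub, neg_sub]
  obtain ⟨B, hB⟩ := hμ.exists_enorm_convFun_le φ'
  obtain ⟨C, hC⟩ := hμ.exists_enorm_convFun_sub_setIntegral_le φ'
  have hf := hμ.continuous_convFun φ'
  have hK : IsCompact (-tsupport φ') := IsCompact.neg φ'.hasCompactSupport
  have hε2 : 0 < ε / 2 := by positivity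
  -- The truncation error is at most `C` on the inner boundary; with the factor `6` this costs at
  -- most `ε / 2`.
  have hε' : 0 < ε / (12 * (C + 1)) := by positivity
  filter_upwards [hν.tv_inter_sub_le θ hA hK hε',
    (hμA φ').enorm_setIntegral_conj_le hA hν hFB hf hB
      (fun δ hδ => hμ.eventually_enorm_convFun_sub_le φ' hδ) hε2] with n h1 h2
  have hAm := (hA.isCompact n).measurableSet
  have hg : Continuous fun t => μ.setIntegral (A n) fun s => φ' (t - s) :=
    μ.continuous_setIntegral (hA.isCompact n) (F := fun t s => φ' (t - s)) (by
      simp only [Function.uncurry_def]; fun_prop)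
  have hdec : (ν.setIntegral (A n) fun t => conj (μ.setIntegral (A n) fun s => φ' (t - s))) =
      (ν.setIntegral (A n) fun t =>
        conj ((μ.setIntegral (A n) fun s => φ' (t - s)) - convFun φ' μ t)) +
      ν.setIntegral (A n) fun t => conj (convFun φ' μ t) := by
    rw [← ν.setIntegral_add_of_continuous (hA.isCompact n) (by fun_prop) (by fun_prop)]
    refine congrArg (ν.setIntegral (A n)) (funext fun t => ?_)
    rw [← map_add, sub_add_cancel]
  have hS : MeasurableSet ((A n)ᶜ - -tsupport φ') :=
    ((hA.isCompact n).isClosed.isOpen_compl.sub_right).measurableSet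
  have e1 : ‖ν.setIntegral (A n) fun t =>
      conj ((μ.setIntegral (A n) fun s => φ' (t - s)) - convFun φ' μ t)‖ₑ ≤
      (ε / 2 : ℝ≥0) * θ (A n) := by
    refine (ν.enorm_setIntegral_le_mul hAm hS (δ := C) fun t _ => ?_).trans ?_
    · rw [RCLike.enorm_conj]
      exact hC _ hAm t
    · rw [Set.inter_comm]
      calc 6 * (C * ν.tv (A n ∩ ((A n)ᶜ - -tsupport φ')))
          ≤ 6 * (C * ((ε / (12 * (C + 1)) : ℝ≥0) * θ (A n))) := by gcongr
        _ = (6 * (C * (ε / (12 * (C + 1)))) : ℝ≥0) * θ (A n) := by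
            simp only [ENNReal.coe_mul]; push_cast; ring
        _ ≤ (ε / 2 : ℝ≥0) * θ (A n) := by
            gcongr
            calc 6 * (C * (ε / (12 * (C + 1)))) ≤ 6 * ((C + 1) * (ε / (12 * (C + 1)))) := by
                  gcongr; simp
              _ = ε / 2 := by field_simp; norm_num
  rw [restrictConv_tilde μ ν (hA.isCompact n), RCLike.enorm_conj]
  simp only [hφ'e]
  rw [hdec]
  calc _ ≤ (ε / 2 : ℝ≥0) * θ (A n) + (ε / 2 : ℝ≥0) * θ (A n) :=
        (enorm_add_le _ _).trans (add_le_add e1 h2)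
    _ = ε * θ (A n) := by rw [← add_mul, ← ENNReal.coe_add, add_halves]

theorem IsEberleinConv.tilde_zero_symm (hA : IsVanHove θ A) {μ : RadonMeasure G}
    (h : IsEberleinConv θ A μ ν.tilde 0) : IsEberleinConv θ A ν μ.tilde 0 := by
  intro φ
  refine (hA.tendsto_inv_mul_iff _).2 fun ε hε => ?_
  filter_upwards [(hA.tendsto_inv_mul_iff _).1 (h (tildeFun φ)) ε hε] with n hn
  rwa [restrictConv_tilde_swap μ ν (hA.isCompact n), RCLike.enorm_conj]

omit [SecondCountableTopology G] [θ.IsAddHaarMeasure] in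
theorem SatisfiesCPP.isFourierBohrCoeff_zero {σ : RadonMeasure (DualGroup G)}
    (h : SatisfiesCPP θ A ν σ) (hσ : σ.IsContinuousMeasure) (χ : DualGroup G) :
    IsFourierBohrCoeff θ A ν χ 0 := by
  obtain ⟨a, ha, hm⟩ := h χ
  rw [hσ χ] at hm
  have h0 : ‖a‖ ^ 2 = 0 := by exact_mod_cast hm.symm
  have : a = 0 := by simpa using h0
  rwa [this] at ha

end Means

end

theorem mainTheorem5 {G : Type*} [AddCommGroup G] [TopologicalSpace G] [IsTopologicalAddGroup G]
    [T2Space G] [LocallyCompactSpace G] [SecondCountableTopology G]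
    [MeasurableSpace G] [BorelSpace G] (θ : Measure G) [θ.IsAddHaarMeasure]
    (A : ℕ → Set G) (hA : IsVanHove θ A)
    (μ ν : RadonMeasure G) (hμ : IsTranslationBounded μ) (hν : IsTranslationBounded ν)
    (hμA : IsBesicovitchAP θ A μ)
    (γ : RadonMeasure G) (hγ : IsAutocorrelation θ A ν γ)
    (σ : RadonMeasure (DualGroup G)) (hσ : IsFourierTransform θ γ σ)
    (hcont : σ.IsContinuousMeasure) (hcpp : SatisfiesCPP θ A ν σ) :
    IsEberleinConv θ A μ ν.tilde 0 ∧ IsEberleinConv θ A ν μ.tilde 0 := by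
  have h := isEberleinConv_tilde_zero hA hμ hν hμA (hcpp.isFourierBohrCoeff_zero hcont)
  exact ⟨h, h.tilde_zero_symm hA⟩
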